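/- Let $k$ be a field of characteristic zero; all vector spaces, algebras and tensor products are over $k$. A rooted tree is a finite, non-empty rooted tree, taken up to isomorphism; $e$ denotes the tree with one vertex. **The Hopf algebra $H_R$ (Connes–Kreimer).** As an algebra, $H_R$ is the polynomial algebra in indeterminates indexed by the rooted trees, and a forest is identified with the corresponding monomial. An admissible cut of $t$ is a set $c$ of edges such that every path from a vertex of $t$ to the root contains at most one edge of $c$; removing the edges of $c$ yields the trunk $R^c(t)$ (the component containing the root) and the forest $P^c(t)$ of the remaining components. The coproduct and counit are the algebra maps with $$\Delta(t)=1\otimes t+t\otimes 1+\sum_{c\neq\emptyset}P^c(t)\otimes R^c(t),\qquad \varepsilon(t)=0,$$ the sum being over the non-empty admissible cuts $c$ of $t$. Let $L:H_R\to H_R$ be the linear map that sends a monomial $t_1\cdots t_m$ to the tree obtained by connecting a new root to the roots of $t_1,\dots,t_m$ (so $L(1)=e$). **The Hopf algebra $A$ (Grossman–Larson).** As a vector space, $A$ has the rooted trees as a basis. The unit is $e$. If the root of $t_1$ has children $s_1,\dots,s_r$ and $t_2$ has $n$ vertices, then $t_1t_2$ is the sum of the $n^r$ trees obtained by attaching the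 subtrees of $t_1$ with roots $s_1,\dots,s_r$ to $t_2$, making each $s_i$ a child of some vertex of $t_2$. The coproduct $\Delta(t)$ is the sum of the $2^r$ terms $t'\otimes t''$ obtained by distributing the $r$ branches at the root of $t$ over the roots of $t'$ and $t''$. The counit is given by $\varepsilon(e)=1$ and $\varepsilon(t)=0$ for $t\neq e$. Let $M:A\to A$ be the linear map with $M(e)=0$ and $M(t)=t\,N(e)$ for all rooted trees $t\ne e$, where $N:A\to A$ is the natural growth operator: $N(t)$ is the sum, over the vertices $v$ of $t$, of the trees obtained from $t$ by attaching one new edge and vertex to $v$ (so $N(e)$ is the tree with two vertices). **The finite dual.** $A^0$ is the Hopf algebra of those $f\in A^*$ whose kernel contains a two-sided ideal of $A$ of finite codimension. Its product is $(fg)(a)=\sum f(a_{(1)})g(a_{(2)})$, its unit is $\varepsilon$, and its coproduct is determined by $\Delta(f)=\sum f_i\otimes f_i'$ if and only if $f(ab)=\sum f_i(a)f_i'(b)$ for all $a,b\in A$; its counit is $f\mapsto f(e)$ and its antipode is $f\mapsto f\circ S_A$, where $S_A$ is the antipode of $A$. **Claim.** The transpose $M^*:A^*\to A^*$, $M^*(f)=f\circ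 M$, maps $A^0$ into $A^0$. Its restriction $M^0:A^0\to A^0$ satisfies the Hochschild equation $$\Delta(M^0(f))=M^0(f)\otimes\varepsilon+(\mathrm{id}\otimes M^0)(\Delta(f))\qquad\text{for all } f\in A^0 .$$ Moreover, there exists a unique Hopf algebra map $\rho:H_R\to A^0$ such that $M^0\circ\rho=\rho\circ L$. -/

import Mathlib

open scoped TensorProduct

section

open WithConv

/-! ## Rooted trees -/

/-- Plane rooted trees (the children of every vertex are ordered): `leaf` is the tree with a single
vertex, and `addChild s t` is the tree `t` with one more child of the root, placed first, the
subtree below that child being `s`. -/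
inductive PlaneTree : Type
  | leaf : PlaneTree
  | addChild (s t : PlaneTree) : PlaneTree

namespace PlaneTree

/-- Isomorphism of the underlying non-plane rooted trees: the congruence generated by exchanging
two neighbouring children of a vertex. -/
inductive Iso : PlaneTree → PlaneTree → Prop
  | refl (t : PlaneTree) : Iso t t
  | symm {s t : PlaneTree} : Iso s t → Iso t s
  | trans {s t u : PlaneTree} : Iso s t → Iso t u → Iso s u
  | congr {s s' t t' : PlaneTree} : Iso s s' → Iso t t' → Iso (addChild s t) (addChild s' t')
  | swap (s s' t : PlaneTree) : Iso (addChild s (addChild s' t)) (addChild s' (addChild s t))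

instance setoid : Setoid PlaneTree := ⟨Iso, Iso.refl, Iso.symm, Iso.trans⟩

/-- The edges of a plane tree. In `addChild s t` these are the edge `new` from the root to the
added child, the edges `left a` for the edges `a` of `s`, and the edges `right a` for the edges `a`
of `t`. -/
inductive Edge : PlaneTree → Type
  | new {s t : PlaneTree} : Edge (addChild s t)
  | left {s t : PlaneTree} (a : Edge s) : Edge (addChild s t)
  | right {s t : PlaneTree} (a : Edge t) : Edge (addChild s t)

/-- The vertices of a plane tree: the root `none`, and for every edge `a` its lower end
`some a`. -/
abbrev Vertex (t : PlaneTree) : Type := Option (Edge t)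

instance : IsEmpty (Edge leaf) := ⟨fun a => nomatch a⟩

/-- The edges of `addChild s t` correspond to the vertices of `s` and the edges of `t`. -/
def Edge.equiv (s t : PlaneTree) : Vertex s ⊕ Edge t ≃ Edge (addChild s t) where
  toFun
    | Sum.inl none => Edge.new
    | Sum.inl (some a) => Edge.left a
    | Sum.inr a => Edge.right a
  invFun
    | Edge.new => Sum.inl none
    | Edge.left a => Sum.inl (some a)
    | Edge.right a => Sum.inr a
  left_inv := by rintro ((_ | a) | a) <;> rfl
  right_inv := by rintro (_ | a | a) <;> rfl

noncomputable instance Edge.instFintype : (t : PlaneTree) → Fintype (Edge t)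
  | leaf => Fintype.ofIsEmpty
  | addChild s t =>
    haveI := Edge.instFintype s
    haveI := Edge.instFintype t
    Fintype.ofEquiv _ (Edge.equiv s t)

end PlaneTree

/-- Rooted trees (non-empty, finite, up to isomorphism). -/
def RTree : Type := Quotient PlaneTree.setoid

namespace RTree

open PlaneTree (leaf addChild)

/-- The rooted tree underlying a plane tree. -/
def mk (t : PlaneTree) : RTree := Quotient.mk _ t

/-- The rooted tree `e` with a single vertex. -/
def e : RTree := mk leaf

/-- `cons s t` is the tree `t` with one more child of the root, the subtree below it being `s`. -/
def cons : RTree → RTree → RTree :=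
  Quotient.map₂ addChild fun _ _ h _ _ h' => PlaneTree.Iso.congr h h'

theorem cons_mk (s t : PlaneTree) : cons (mk s) (mk t) = mk (addChild s t) := rfl

instance cons_leftComm : LeftCommutative cons where
  left_comm a b c := by
    induction a using Quotient.inductionOn with | _ a
    induction b using Quotient.inductionOn with | _ b
    induction c using Quotient.inductionOn with | _ c
    exact Quotient.sound (PlaneTree.Iso.swap a b c)

/-- The operator `B₊`: the tree obtained by connecting a new root to the roots of the trees of
a forest. -/
def node (F : Multiset RTree) : RTree := F.foldr cons e

/-- The forest of the subtrees below the children of the root of a plane tree. -/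
def planeChildren : PlaneTree → Multiset RTree
  | leaf => 0
  | addChild s t => mk s ::ₘ planeChildren t

/-- The operator `B₋`: the forest obtained by removing the root of a tree. -/
def children : RTree → Multiset RTree :=
  Quotient.lift planeChildren fun s t h => by
    change PlaneTree.Iso s t at h
    induction h with
    | refl => rfl
    | symm _ ih => exact ih.symm
    | trans _ _ ih ih' => exact ih.trans ih'
    | congr h _ _ ih =>
      simp only [planeChildren, ih]
      congr 1
      exact Quotient.sound h
    | swap => exact Multiset.cons_swap _ _ _

theorem ind {P : RTree → Prop} (he : P e) (hcons : ∀ s t, P s → P t → P (cons s t))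
    (t : RTree) : P t := by
  induction t using Quotient.inductionOn with | _ t
  induction t with
  | leaf => exact he
  | addChild s t hs ht => exact hcons _ _ hs ht

@[simp] theorem node_zero : node 0 = e := rfl

@[simp] theorem node_cons (s : RTree) (F : Multiset RTree) :
    node (s ::ₘ F) = cons s (node F) := Multiset.foldr_cons _ _ _ _

@[simp] theorem children_e : children e = 0 := rfl

@[simp] theorem children_mk_leaf : children (mk leaf) = 0 := rfl

@[simp] theorem children_mk_addChild (s t : PlaneTree) :
    children (mk (addChild s t)) = mk s ::ₘ children (mk t) := rfl

@[simp] theorem children_cons (s t : RTree) : children (cons s t) = s ::ₘ children t := by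
  induction s using Quotient.inductionOn
  induction t using Quotient.inductionOn
  rfl

@[simp] theorem children_node (F : Multiset RTree) : children (node F) = F := by
  induction F using Multiset.induction with
  | empty => rfl
  | cons s F ih => rw [node_cons, children_cons, ih]

@[simp] theorem node_children (t : RTree) : node (children t) = t := by
  induction t using ind with
  | he => rfl
  | hcons s t _ ih => rw [children_cons, node_cons, ih]

/-- A plane representative of a rooted tree. -/
noncomputable def plane (t : RTree) : PlaneTree := Quotient.out t

theorem mk_plane (t : RTree) : mk (plane t) = t := Quotient.out_eq t

/-- The number of vertices of a plane tree. -/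
def planeSize : PlaneTree → ℕ
  | leaf => 1
  | addChild s t => planeSize s + planeSize t

/-- The number of vertices of a rooted tree. -/
def size : RTree → ℕ :=
  Quotient.lift planeSize fun s t h => by
    change PlaneTree.Iso s t at h
    induction h with
    | refl => rfl
    | symm _ ih => exact ih.symm
    | trans _ _ ih ih' => exact ih.trans ih'
    | congr h _ ih ih' => simp only [planeSize, ih, ih']
    | swap => simp only [planeSize]; omega

theorem size_cons (s t : RTree) : size (cons s t) = size s + size t := by
  induction s using Quotient.inductionOn
  induction t using Quotient.inductionOn
  rfl

theorem size_pos (t : RTree) : 0 < size t := by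
  induction t using ind with
  | he => exact Nat.one_pos
  | hcons s t _ ih => rw [size_cons]; omega

theorem size_node (F : Multiset RTree) : size (node F) = (F.map size).sum + 1 := by
  induction F using Multiset.induction with
  | empty => rfl
  | cons s F ih => rw [node_cons, size_cons, ih, Multiset.map_cons, Multiset.sum_cons]; ring

end RTree

namespace PlaneTree

open RTree (mk cons node)

/-- The forest below the root of the tree `graft t g`, where `g` prescribes the trees that are
attached to the vertices of `t` other than the root. -/
def graftForest : (t : PlaneTree) → (Edge t → Multiset RTree) → Multiset RTree
  | leaf, _ => 0
  | addChild s t, g =>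
    node (g Edge.new + graftForest s fun a => g (Edge.left a)) ::ₘ
      graftForest t fun a => g (Edge.right a)

/-- The rooted tree obtained from `t` by attaching to every vertex `v` of `t` the trees of the
forest `g v`: their roots become children of `v`. -/
def graft (t : PlaneTree) (g : Vertex t → Multiset RTree) : RTree :=
  node (g none + graftForest t fun a => g (some a))

/-- `OnPath a b` : the edge `a` lies on the path from the lower end of the edge `b` to the root. -/
def OnPath : (t : PlaneTree) → Edge t → Edge t → Prop
  | addChild _ _, Edge.new, Edge.new => True
  | addChild _ _, Edge.new, Edge.left _ => True
  | addChild s _, Edge.left a, Edge.left b => OnPath s a b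
  | addChild _ t, Edge.right a, Edge.right b => OnPath t a b
  | addChild _ _, _, _ => False

/-- A set of edges of `t` is an admissible cut if the path from any vertex to the root contains at
most one of its edges. (For the root itself there is nothing to check.) -/
def Admissible (t : PlaneTree) (c : Set (Edge t)) : Prop :=
  ∀ v : Edge t, {a | a ∈ c ∧ OnPath t a v}.Subsingleton

open Classical in
/-- The cut branches `P^c(t)` of an admissible cut `c` of `t`. -/
noncomputable def branches : (t : PlaneTree) → Set (Edge t) → Multiset RTree
  | leaf, _ => 0
  | addChild s t, c =>
    (if Edge.new ∈ c then {mk s} else branches s {a | Edge.left a ∈ c}) +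
      branches t {a | Edge.right a ∈ c}

open Classical in
/-- The trunk `R^c(t)` of a cut `c` of `t`, the part which contains the root. -/
noncomputable def trunk : (t : PlaneTree) → Set (Edge t) → RTree
  | leaf, _ => RTree.e
  | addChild s t, c =>
    if Edge.new ∈ c then trunk t {a | Edge.right a ∈ c}
    else cons (trunk s {a | Edge.left a ∈ c}) (trunk t {a | Edge.right a ∈ c})

theorem onPath_self : (t : PlaneTree) → (a : Edge t) → OnPath t a a
  | addChild _ _, Edge.new => trivial
  | addChild s _, Edge.left a => onPath_self s a
  | addChild _ t, Edge.right a => onPath_self t a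

theorem admissible_addChild (s t : PlaneTree) (c : Set (Edge (addChild s t))) :
    Admissible (addChild s t) c ↔
      ((Edge.new ∈ c ∧ {a | Edge.left a ∈ c} = (∅ : Set (Edge s))) ∨
        (Edge.new ∉ c ∧ Admissible s {a | Edge.left a ∈ c})) ∧
      Admissible t {a | Edge.right a ∈ c} := by
  constructor
  · intro h
    refine ⟨?_, ?_⟩
    · by_cases h0 : (Edge.new : Edge (addChild s t)) ∈ c
      · left
        refine ⟨h0, Set.eq_empty_iff_forall_notMem.2 fun a ha => ?_⟩
        have := @h (Edge.left a) Edge.new ⟨h0, trivial⟩ (Edge.left a)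
          ⟨ha, onPath_self s a⟩
        cases this
      · right
        refine ⟨h0, fun v a ha b hb => ?_⟩
        have := @h (Edge.left v) (Edge.left a) ⟨ha.1, ha.2⟩ (Edge.left b)
          ⟨hb.1, hb.2⟩
        cases this
        rfl
    · intro v a ha b hb
      have := @h (Edge.right v) (Edge.right a) ⟨ha.1, ha.2⟩ (Edge.right b) ⟨hb.1, hb.2⟩
      cases this
      rfl
  · rintro ⟨h, ht⟩ v a ⟨ha, hav⟩ b ⟨hb, hbv⟩
    rcases v with _ | v | v <;> rcases a with _ | a | a <;> rcases b with _ | b | b <;>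
      first
      | rfl
      | exact hav.elim
      | exact hbv.elim
      | skip
    · rcases h with ⟨_, h⟩ | ⟨h, _⟩
      · have : b ∈ (∅ : Set (Edge s)) := h ▸ hb
        exact this.elim
      · exact (h ha).elim
    · rcases h with ⟨_, h⟩ | ⟨h, _⟩
      · have : a ∈ (∅ : Set (Edge s)) := h ▸ ha
        exact this.elim
      · exact (h hb).elim
    · rcases h with ⟨_, h⟩ | ⟨_, h⟩
      · have : a ∈ (∅ : Set (Edge s)) := h ▸ ha
        exact this.elim
      · have := @h v a ⟨ha, hav⟩ b ⟨hb, hbv⟩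
        rw [this]
    · have := @ht v a ⟨ha, hav⟩ b ⟨hb, hbv⟩
      rw [this]

end PlaneTree

/-! ## The finite dual of a Hopf algebra -/

section SeparatingFunctionals

variable {k E F X : Type*} [Field k] [AddCommGroup E] [Module k E] [AddCommGroup F] [Module k F]

/-- If the functionals `φ x` separate the points of `E`, the maps `φ x ⊗ id` separate the points
of `E ⊗ F`. -/
theorem tensor_eq_zero_of_left (φ : X → E →ₗ[k] k) (hφ : ∀ e, (∀ x, φ x e = 0) → e = 0)
    (z : E ⊗[k] F) (hz : ∀ x, TensorProduct.lid k F ((φ x).rTensor F z) = 0) : z = 0 := by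
  classical
  let b := Module.Free.chooseBasis k F
  let eq := TensorProduct.equivFinsuppOfBasisRight (M := E) b
  have key : ∀ (z : E ⊗[k] F) x i, φ x (eq z i) =
      b.repr (TensorProduct.lid k F ((φ x).rTensor F z)) i := by
    intro z x i
    induction z using TensorProduct.induction_on with
    | zero => simp
    | tmul e f => simp [eq, mul_comm]
    | add u v hu hv => simp [hu, hv]
  apply eq.injective
  ext i
  rw [map_zero, Finsupp.zero_apply]
  apply hφ
  intro x
  rw [key, hz]
  simp

/-- If the functionals `φ x` separate the points of `F`, the maps `id ⊗ φ x` separate the points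
of `E ⊗ F`. -/
theorem tensor_eq_zero_of_right (φ : X → F →ₗ[k] k) (hφ : ∀ e, (∀ x, φ x e = 0) → e = 0)
    (z : E ⊗[k] F) (hz : ∀ x, TensorProduct.rid k E ((φ x).lTensor E z) = 0) : z = 0 := by
  apply (TensorProduct.comm k E F).injective
  rw [map_zero]
  apply tensor_eq_zero_of_left φ hφ
  intro x
  rw [← hz x]
  clear hz
  induction z using TensorProduct.induction_on with
  | zero => simp
  | tmul e f => simp
  | add u v hu hv => simp only [map_add, hu, hv]

end SeparatingFunctionals

section FiniteDual

variable (k A : Type*) [Field k] [Ring A]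

/-- A linear functional on the algebra `A` lies in the finite dual if its kernel contains a
two-sided ideal of finite codimension. -/
def IsFiniteFunctional {k A : Type*} [Field k] [Ring A] [Algebra k A] (f : A →ₗ[k] k) : Prop :=
  ∃ I : Submodule k A, (∀ a : A, ∀ x ∈ I, a * x ∈ I ∧ x * a ∈ I) ∧
    FiniteDimensional k (A ⧸ I) ∧ I ≤ LinearMap.ker f

theorem IsFiniteFunctional.of_inf {k A : Type*} [Field k] [Ring A] [Algebra k A]
    {f g h : A →ₗ[k] k} (hf : IsFiniteFunctional f) (hg : IsFiniteFunctional g)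
    (hh : LinearMap.ker f ⊓ LinearMap.ker g ≤ LinearMap.ker h) : IsFiniteFunctional h := by
  obtain ⟨I, hI, hfin, hIf⟩ := hf
  obtain ⟨J, hJ, hfinJ, hJg⟩ := hg
  refine ⟨I ⊓ J, fun a x hx => ⟨⟨(hI a x hx.1).1, (hJ a x hx.2).1⟩,
    ⟨(hI a x hx.1).2, (hJ a x hx.2).2⟩⟩, ?_, (inf_le_inf hIf hJg).trans hh⟩
  have h1 : I.CoFG := hfin
  have h2 : J.CoFG := hfinJ
  exact h1.inf h2

/-- The convolution product of two functionals of the finite dual lies in the finite dual. -/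
theorem IsFiniteFunctional.convMul {k A : Type*} [Field k] [Ring A] [Bialgebra k A]
    {f g : A →ₗ[k] k} (hf : IsFiniteFunctional f) (hg : IsFiniteFunctional g) :
    IsFiniteFunctional (toConv f * toConv g).ofConv := by
  obtain ⟨I, hI, hfin, hIf⟩ := hf
  obtain ⟨J, hJ, hfinJ, hJg⟩ := hg
  let q : A ⊗[k] A →ₗ[k] (A ⧸ I) ⊗[k] (A ⧸ J) := TensorProduct.map I.mkQ J.mkQ
  have hq : ∀ x y : A ⊗[k] A, q y = 0 → q (x * y) = 0 ∧ q (y * x) = 0 := by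
    let lI : A → (A ⧸ I) →ₗ[k] (A ⧸ I) := fun a =>
      I.mapQ I (LinearMap.mulLeft k a) (fun x hx => (hI a x hx).1)
    let rI : A → (A ⧸ I) →ₗ[k] (A ⧸ I) := fun a =>
      I.mapQ I (LinearMap.mulRight k a) (fun x hx => (hI a x hx).2)
    let lJ : A → (A ⧸ J) →ₗ[k] (A ⧸ J) := fun a =>
      J.mapQ J (LinearMap.mulLeft k a) (fun x hx => (hJ a x hx).1)
    let rJ : A → (A ⧸ J) →ₗ[k] (A ⧸ J) := fun a =>
      J.mapQ J (LinearMap.mulRight k a) (fun x hx => (hJ a x hx).2)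
    have h1 : ∀ (a b : A) (y : A ⊗[k] A),
        q ((a ⊗ₜ b) * y) = TensorProduct.map (lI a) (lJ b) (q y) := by
      intro a b y
      induction y using TensorProduct.induction_on with
      | zero => simp
      | tmul c d => rw [Algebra.TensorProduct.tmul_mul_tmul]; rfl
      | add u v hu hv => simp [mul_add, hu, hv]
    have h2 : ∀ (a b : A) (y : A ⊗[k] A),
        q (y * (a ⊗ₜ b)) = TensorProduct.map (rI a) (rJ b) (q y) := by
      intro a b y
      induction y using TensorProduct.induction_on with
      | zero => simp
      | tmul c d => rw [Algebra.TensorProduct.tmul_mul_tmul]; rfl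
      | add u v hu hv => simp [add_mul, hu, hv]
    intro x y hy
    induction x using TensorProduct.induction_on with
    | zero => simp
    | tmul a b => rw [h1, h2, hy]; simp
    | add u v hu hv => simp [add_mul, mul_add, hu, hv]
  refine ⟨LinearMap.ker (q ∘ₗ Coalgebra.comul), ?_, ?_, ?_⟩
  · intro a x hx
    simp only [LinearMap.mem_ker, LinearMap.comp_apply, Bialgebra.comul_mul] at hx ⊢
    exact hq _ _ hx
  · exact Module.Finite.equiv (LinearMap.quotKerEquivRange (q ∘ₗ Coalgebra.comul)).symm
  · intro x hx
    simp only [LinearMap.mem_ker, LinearMap.comp_apply] at hx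
    have : TensorProduct.map f g = TensorProduct.map (I.liftQ f hIf) (J.liftQ g hJg) ∘ₗ q := by
      ext; simp [q]
    simp [this, hx]

/-- The finite dual `A⁰` of a bialgebra `A`: the algebra, under the convolution product
`(f * g)(a) = ∑ f(a₁) g(a₂)` and with unit the counit of `A`, of all functionals whose kernel
contains a two-sided ideal of finite codimension. -/
noncomputable def finiteDualSubalgebra [Bialgebra k A] : Subalgebra k (WithConv (A →ₗ[k] k)) where
  carrier := {f | IsFiniteFunctional f.ofConv}
  mul_mem' hf hg := hf.convMul hg
  add_mem' hf hg := hf.of_inf hg fun x hx => by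
    have h1 := LinearMap.mem_ker.1 hx.1
    have h2 := LinearMap.mem_ker.1 hx.2
    rw [LinearMap.mem_ker, WithConv.ofConv_add, LinearMap.add_apply, h1, h2, add_zero]
  algebraMap_mem' r := by
    refine ⟨LinearMap.ker (Coalgebra.counit (R := k) (A := A)), ?_, ?_, ?_⟩
    · intro a x hx
      have h : Coalgebra.counit (R := k) x = 0 := hx
      simp [h]
    · exact Module.Finite.equiv
        (LinearMap.quotKerEquivRange (Coalgebra.counit (R := k) (A := A))).symm
    · intro x hx
      have h : Coalgebra.counit (R := k) x = 0 := hx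
      simp [h]

/-- The finite dual `A⁰` of `A` as a type. When `A` is a Hopf algebra it is a Hopf algebra, see below. -/
def FiniteDual [Bialgebra k A] : Type _ := ↥(finiteDualSubalgebra k A)

namespace FiniteDual

variable {k A}

section Bialg

variable [Bialgebra k A]

noncomputable instance : Ring (FiniteDual k A) :=
  inferInstanceAs (Ring ↥(finiteDualSubalgebra k A))

noncomputable instance : Algebra k (FiniteDual k A) :=
  inferInstanceAs (Algebra k ↥(finiteDualSubalgebra k A))

/-- The inclusion of `A⁰` in the dual space of `A`. -/
noncomputable def toDual : FiniteDual k A →ₗ[k] Module.Dual k A where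
  toFun f := f.1.ofConv
  map_add' _ _ := rfl
  map_smul' _ _ := rfl

/-- A functional satisfying the finiteness condition, as an element of `A⁰`. -/
def mk (f : Module.Dual k A) (hf : IsFiniteFunctional f) : FiniteDual k A := ⟨toConv f, hf⟩

@[simp] theorem toDual_mk (f : Module.Dual k A) (hf : IsFiniteFunctional f) :
    toDual (mk f hf) = f := rfl

theorem isFiniteFunctional (f : FiniteDual k A) : IsFiniteFunctional (toDual f) := f.2

@[simp] theorem mk_toDual (f : FiniteDual k A) (hf : IsFiniteFunctional (toDual f)) :
    mk (toDual f) hf = f := rfl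

theorem toDual_injective : Function.Injective (toDual : FiniteDual k A → Module.Dual k A) :=
  fun _ _ h => Subtype.ext (WithConv.ext h)

theorem toDual_one : toDual (1 : FiniteDual k A) = Coalgebra.counit := by
  ext a
  change algebraMap k k (Coalgebra.counit a) = _
  simp

/-- A linear endomorphism `T` of `A` whose transpose preserves the finite dual induces a linear
endomorphism of the finite dual, the restriction `f ↦ f ∘ T` of the transpose. -/
noncomputable def restrictTranspose (T : A →ₗ[k] A)
    (hT : ∀ f : Module.Dual k A, IsFiniteFunctional f → IsFiniteFunctional (T.dualMap f)) :
    FiniteDual k A →ₗ[k] FiniteDual k A where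
  toFun f := mk (T.dualMap (toDual f)) (hT _ f.isFiniteFunctional)
  map_add' _ _ := rfl
  map_smul' _ _ := rfl

/-- Evaluation of the functionals in the finite dual at `a`. -/
noncomputable def ev (a : A) : FiniteDual k A →ₗ[k] k :=
  LinearMap.applyₗ a ∘ₗ toDual

@[simp] theorem ev_apply (a : A) (f : FiniteDual k A) : ev a f = toDual f a := rfl

theorem sep (f : FiniteDual k A) (h : ∀ a, ev a f = 0) : f = 0 :=
  toDual_injective (LinearMap.ext fun a => by rw [map_zero]; exact h a)

/-- The pairing of `A⁰ ⊗ A⁰` with `a ⊗ b`, that is `f ⊗ g ↦ f(a) g(b)`. -/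
noncomputable def ev₂ (a b : A) : FiniteDual k A ⊗[k] FiniteDual k A →ₗ[k] k :=
  LinearMap.mul' k k ∘ₗ TensorProduct.map (ev a) (ev b)

@[simp] theorem ev₂_tmul (a b : A) (f g : FiniteDual k A) :
    ev₂ a b (f ⊗ₜ g) = toDual f a * toDual g b := by simp [ev₂]

theorem sep₂ (z : FiniteDual k A ⊗[k] FiniteDual k A) (h : ∀ a b, ev₂ a b z = 0) : z = 0 := by
  refine tensor_eq_zero_of_left ev sep z fun a => sep _ fun b => ?_
  rw [← h a b]
  clear h
  induction z using TensorProduct.induction_on with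
  | zero => simp
  | tmul e f => simp
  | add u v hu hv => simp only [map_add, hu, hv]

theorem ext₂ {y z : FiniteDual k A ⊗[k] FiniteDual k A} (h : ∀ a b, ev₂ a b y = ev₂ a b z) :
    y = z :=
  sub_eq_zero.1 (sep₂ _ fun a b => by simp [h])

/-- The transpose of the multiplication maps `A⁰` into `A⁰ ⊗ A⁰`. -/
theorem exists_comul (f : FiniteDual k A) :
    ∃ y : FiniteDual k A ⊗[k] FiniteDual k A, ∀ a b, ev₂ a b y = toDual f (a * b) := by
  obtain ⟨I, hI, hfin, hIf⟩ := f.isFiniteFunctional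
  let b := Module.finBasis k (A ⧸ I)
  choose e he using fun i => I.mkQ_surjective (b i)
  have h1 : ∀ i, IsFiniteFunctional (b.coord i ∘ₗ I.mkQ) := fun i =>
    ⟨I, hI, hfin, fun x hx => by
      have : I.mkQ x = 0 := by simpa using hx
      simp only [LinearMap.mem_ker, LinearMap.comp_apply, this, map_zero]⟩
  have h2 : ∀ i, IsFiniteFunctional (toDual f ∘ₗ LinearMap.mulLeft k (e i)) := fun i =>
    ⟨I, hI, hfin, fun x hx => hIf (hI (e i) x hx).1⟩
  refine ⟨∑ i, (mk _ (h1 i)) ⊗ₜ (mk _ (h2 i)), ?_⟩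
  intro x y
  simp only [map_sum, ev₂_tmul, toDual_mk, LinearMap.comp_apply, LinearMap.mulLeft_apply]
  have h3 : x - ∑ i, b.coord i (I.mkQ x) • e i ∈ I := by
    have h5 : I.mkQ (x - ∑ i, b.coord i (I.mkQ x) • e i) = 0 := by
      simp only [map_sub, map_sum, map_smul, he]
      rw [sub_eq_zero]
      exact (b.sum_repr _).symm
    exact (Submodule.Quotient.mk_eq_zero I).1 h5
  have h4 : toDual f ((x - ∑ i, b.coord i (I.mkQ x) • e i) * y) = 0 := hIf (hI y _ h3).2
  rw [sub_mul, map_sub, sub_eq_zero] at h4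
  rw [h4]
  simp [Finset.sum_mul]

/-- The coalgebra structure of the finite dual: the comultiplication is the restriction of the
transpose of the multiplication of `A`, that is `Δ f = ∑ fᵢ ⊗ f'ᵢ` if and only if
`f(ab) = ∑ fᵢ(a) f'ᵢ(b)` for all `a, b`, and the counit is `f ↦ f(1)`. -/
noncomputable instance : CoalgebraStruct k (FiniteDual k A) where
  comul :=
    { toFun := fun f => (exists_comul f).choose
      map_add' := fun f g => ext₂ fun a b => by
        rw [map_add (ev₂ a b), (exists_comul f).choose_spec, (exists_comul g).choose_spec,
          (exists_comul (f + g)).choose_spec]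
        rfl
      map_smul' := fun r f => ext₂ fun a b => by
        rw [map_smul (ev₂ a b), (exists_comul f).choose_spec, (exists_comul (r • f)).choose_spec]
        rfl }
  counit := ev 1

theorem ev₂_comul (f : FiniteDual k A) (a b : A) :
    ev₂ a b (Coalgebra.comul (R := k) f) = toDual f (a * b) :=
  (exists_comul f).choose_spec a b

theorem counit_apply (f : FiniteDual k A) :
    Coalgebra.counit (R := k) f = toDual f 1 := rfl

theorem rTensor_ev_comul (f : FiniteDual k A) (a b : A) :
    ev b (TensorProduct.lid k _ ((ev a).rTensor _ (Coalgebra.comul (R := k) f))) =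
      toDual f (a * b) := by
  rw [← ev₂_comul]
  induction Coalgebra.comul (R := k) f using TensorProduct.induction_on with
  | zero => simp
  | tmul e f => simp
  | add u v hu hv => simp only [map_add, hu, hv]

theorem lTensor_ev_comul (f : FiniteDual k A) (a b : A) :
    ev a (TensorProduct.rid k _ ((ev b).lTensor _ (Coalgebra.comul (R := k) f))) =
      toDual f (a * b) := by
  rw [← ev₂_comul]
  induction Coalgebra.comul (R := k) f using TensorProduct.induction_on with
  | zero => simp
  | tmul e f => simp [mul_comm]
  | add u v hu hv => simp only [map_add, hu, hv]

noncomputable instance : Coalgebra k (FiniteDual k A) where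
  coassoc := by
    ext1 f
    rw [← sub_eq_zero]
    refine tensor_eq_zero_of_left ev sep _ fun a => ext₂ fun b c => ?_
    simp only [LinearMap.comp_apply, map_sub, LinearEquiv.coe_coe, map_zero]
    have h1 : ∀ z : FiniteDual k A ⊗[k] FiniteDual k A,
        ev₂ b c (TensorProduct.lid k _ ((ev a).rTensor _ (TensorProduct.assoc k _ _ _
          ((Coalgebra.comul (R := k) (A := FiniteDual k A)).rTensor _ z)))) = ev₂ (a * b) c z := by
      intro z
      induction z using TensorProduct.induction_on with
      | zero => simp
      | tmul e f =>
        rw [ev₂_tmul, ← ev₂_comul, LinearMap.rTensor_tmul]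
        induction Coalgebra.comul (R := k) e using TensorProduct.induction_on with
        | zero => simp
        | tmul e f => simp [mul_assoc]
        | add u v hu hv => simp only [map_add, hu, hv, TensorProduct.add_tmul, add_mul]
      | add u v hu hv => simp only [map_add, hu, hv]
    have h2 : ∀ z : FiniteDual k A ⊗[k] FiniteDual k A,
        ev₂ b c (TensorProduct.lid k _ ((ev a).rTensor _
          ((Coalgebra.comul (R := k) (A := FiniteDual k A)).lTensor _ z))) = ev₂ a (b * c) z := by
      intro z
      induction z using TensorProduct.induction_on with
      | zero => simp
      | tmul e f => simp [ev₂_comul]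
      | add u v hu hv => simp only [map_add, hu, hv]
    rw [h1, h2, ev₂_comul, ev₂_comul, mul_assoc, sub_self]
  rTensor_counit_comp_comul := by
    ext1 f
    apply (TensorProduct.lid k _).injective
    rw [← sub_eq_zero]
    refine sep _ fun a => ?_
    rw [map_sub]
    have := rTensor_ev_comul f 1 a
    simp only [LinearMap.comp_apply]
    rw [show (Coalgebra.counit : FiniteDual k A →ₗ[k] k) = ev 1 from rfl, this]
    simp
  lTensor_counit_comp_comul := by
    ext1 f
    apply (TensorProduct.rid k _).injective
    rw [← sub_eq_zero]
    refine sep _ fun a => ?_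
    rw [map_sub]
    have := lTensor_ev_comul f a 1
    simp only [LinearMap.comp_apply]
    rw [show (Coalgebra.counit : FiniteDual k A →ₗ[k] k) = ev 1 from rfl, this]
    simp

theorem ev_mul {ι : Type*} (f g : FiniteDual k A) {a : A} (r : Coalgebra.Repr k a ι) :
    toDual (f * g) a =
      ∑ i ∈ r.index, toDual f (r.left i) * toDual g (r.right i) :=
  r.convMul_apply f.1 g.1

theorem ev₂_mul {ι κ : Type*} (y z : FiniteDual k A ⊗[k] FiniteDual k A) {a b : A}
    (r : Coalgebra.Repr k a ι) (s : Coalgebra.Repr k b κ) :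
    ev₂ a b (y * z) = ∑ i ∈ r.index, ∑ j ∈ s.index,
      ev₂ (r.left i) (s.left j) y * ev₂ (r.right i) (s.right j) z := by
  induction y using TensorProduct.induction_on with
  | zero => simp
  | add u v hu hv => simp only [add_mul, map_add, hu, hv, Finset.sum_add_distrib]
  | tmul f g =>
    induction z using TensorProduct.induction_on with
    | zero => simp
    | add u v hu hv => simp only [mul_add, map_add, hu, hv, Finset.sum_add_distrib]
    | tmul f' g' =>
      rw [Algebra.TensorProduct.tmul_mul_tmul, ev₂_tmul, ev_mul f f' r, ev_mul g g' s,
        Finset.sum_mul_sum]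
      simp only [ev₂_tmul]
      exact Finset.sum_congr rfl fun i _ => Finset.sum_congr rfl fun j _ => by ring

noncomputable instance : Bialgebra k (FiniteDual k A) :=
  Bialgebra.mk' k (FiniteDual k A)
    (by
      rw [counit_apply]
      change Coalgebra.counit (R := k) (1 : A) = 1
      simp)
    (by
      intro f g
      simp only [counit_apply]
      change LinearMap.mul' k k (TensorProduct.map (toDual f) (toDual g)
        (Coalgebra.comul (R := k) (1 : A))) = _
      rw [Bialgebra.comul_one, Algebra.TensorProduct.one_def]
      simp)
    (by
      refine ext₂ fun a b => ?_
      rw [ev₂_comul, Algebra.TensorProduct.one_def, ev₂_tmul]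
      change Coalgebra.counit (R := k) (a * b) =
        Coalgebra.counit (R := k) a * Coalgebra.counit (R := k) b
      simp)
    (by
      intro f g
      refine ext₂ fun a b => ?_
      let r := Coalgebra.Repr.arbitrary k a
      let s := Coalgebra.Repr.arbitrary k b
      rw [ev₂_comul, ev₂_mul _ _ r s]
      simp only [ev₂_comul]
      change LinearMap.mul' k k (TensorProduct.map (toDual f) (toDual g)
        (Coalgebra.comul (R := k) (a * b))) = _
      rw [Bialgebra.comul_mul, ← r.eq, ← s.eq, Finset.sum_mul_sum]
      simp [map_sum])

end Bialg

section Hopf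

variable [HopfAlgebra k A]

theorem antipode_mem (f : FiniteDual k A) :
    IsFiniteFunctional (toDual f ∘ₗ HopfAlgebra.antipode k) := by
  obtain ⟨I, hI, hfin, hIf⟩ := f.isFiniteFunctional
  refine ⟨LinearMap.ker (I.mkQ ∘ₗ HopfAlgebra.antipode k), ?_, ?_, ?_⟩
  · intro a x hx
    simp only [LinearMap.mem_ker, LinearMap.comp_apply, Submodule.mkQ_apply,
      Submodule.Quotient.mk_eq_zero, HopfAlgebra.antipode_mul_antidistrib] at hx ⊢
    exact (hI _ _ hx).symm
  · exact Module.Finite.equiv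
      (LinearMap.quotKerEquivRange (I.mkQ ∘ₗ HopfAlgebra.antipode k)).symm
  · intro x hx
    simp only [LinearMap.mem_ker, LinearMap.comp_apply, Submodule.mkQ_apply,
      Submodule.Quotient.mk_eq_zero] at hx ⊢
    exact hIf hx

/-- The antipode of the finite dual is the restriction of the transpose of the antipode. -/
noncomputable def antipodeMap : FiniteDual k A →ₗ[k] FiniteDual k A where
  toFun f := mk _ (antipode_mem f)
  map_add' _ _ := rfl
  map_smul' _ _ := rfl

noncomputable instance : HopfAlgebra k (FiniteDual k A) where
  antipode := antipodeMap
  mul_antipode_rTensor_comul := by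
    ext1 f
    rw [← sub_eq_zero]
    refine sep _ fun a => ?_
    rw [map_sub, sub_eq_zero]
    let r := Coalgebra.Repr.arbitrary k a
    have h : ∀ y : FiniteDual k A ⊗[k] FiniteDual k A,
        ev a (LinearMap.mul' k _ (antipodeMap.rTensor _ y)) =
          ∑ i ∈ r.index, ev₂ (HopfAlgebra.antipode k (r.left i)) (r.right i) y := by
      intro y
      induction y using TensorProduct.induction_on with
      | zero => simp
      | add u v hu hv => simp only [map_add, hu, hv, Finset.sum_add_distrib]
      | tmul f g =>
        rw [LinearMap.rTensor_tmul, LinearMap.mul'_apply, ev_apply, ev_mul _ _ r]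
        simp only [ev₂_tmul]
        rfl
    simp only [LinearMap.comp_apply, h, ev₂_comul]
    rw [← map_sum, HopfAlgebra.sum_antipode_mul_eq_algebraMap_counit, counit_apply,
      Algebra.algebraMap_eq_smul_one, map_smul, Algebra.linearMap_apply,
      Algebra.algebraMap_eq_smul_one, map_smul, smul_eq_mul, smul_eq_mul, mul_comm]
    rfl
  mul_antipode_lTensor_comul := by
    ext1 f
    rw [← sub_eq_zero]
    refine sep _ fun a => ?_
    rw [map_sub, sub_eq_zero]
    let r := Coalgebra.Repr.arbitrary k a
    have h : ∀ y : FiniteDual k A ⊗[k] FiniteDual k A,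
        ev a (LinearMap.mul' k _ (antipodeMap.lTensor _ y)) =
          ∑ i ∈ r.index, ev₂ (r.left i) (HopfAlgebra.antipode k (r.right i)) y := by
      intro y
      induction y using TensorProduct.induction_on with
      | zero => simp
      | add u v hu hv => simp only [map_add, hu, hv, Finset.sum_add_distrib]
      | tmul f g =>
        rw [LinearMap.lTensor_tmul, LinearMap.mul'_apply, ev_apply, ev_mul _ _ r]
        simp only [ev₂_tmul]
        rfl
    simp only [LinearMap.comp_apply, h, ev₂_comul]
    rw [← map_sum, HopfAlgebra.sum_mul_antipode_eq_algebraMap_counit, counit_apply,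
      Algebra.algebraMap_eq_smul_one, map_smul, Algebra.linearMap_apply,
      Algebra.algebraMap_eq_smul_one, map_smul, smul_eq_mul, smul_eq_mul, mul_comm]
    rfl

end Hopf

end FiniteDual

end FiniteDual

/-! ## The Hochschild equation -/

/-- A linear endomorphism `L` of a bialgebra satisfies the Hochschild (1-cocycle) equation if
`Δ ∘ L = L ⊗ 1 + (id ⊗ L) ∘ Δ`. -/
def HochschildEquation {k H : Type*} [Field k] [Ring H] [Bialgebra k H] (L : H →ₗ[k] H) : Prop :=
  ∀ x : H, Coalgebra.comul (R := k) (L x) =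
    L x ⊗ₜ[k] (1 : H) + L.lTensor H (Coalgebra.comul (R := k) x)

/-! ## Antipodes of filtered connected bialgebras -/

section ConnectedAntipode

variable {k H : Type*} [Field k] [Ring H] [Bialgebra k H]

/-- The map `η ∘ ε - id`, as an element of the convolution algebra. -/
noncomputable def augConv (k H : Type*) [Field k] [Ring H] [Bialgebra k H] :
    WithConv (H →ₗ[k] H) := 1 - toConv LinearMap.id

theorem augConv_pow_eq_zero (F : ℕ → Submodule k H) (hmono : Monotone F)
    (h0 : ∀ x ∈ F 0, algebraMap k H (Coalgebra.counit x) = x)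
    (hΔ : ∀ n, ∀ x ∈ F (n + 1), Coalgebra.comul (R := k) x ∈
      Submodule.span k {z : H ⊗[k] H | ∃ a b, z = a ⊗ₜ b ∧ (a ∈ F n ∨ b = 1)})
    (n m : ℕ) (hnm : n < m) (x : H) (hx : x ∈ F n) : (augConv k H ^ m).ofConv x = 0 := by
  induction m generalizing n x with
  | zero => omega
  | succ m ih =>
    rcases m with _ | m
    · obtain rfl : n = 0 := by omega
      simp [augConv, h0 x hx]
    · rw [pow_succ, LinearMap.convMul_apply]
      have hx' := hΔ m x (hmono (by omega : n ≤ m + 1) hx)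
      generalize Coalgebra.comul (R := k) x = z at hx' ⊢
      induction hx' using Submodule.span_induction with
      | zero => simp
      | add u v _ _ hu hv => simp only [map_add, hu, hv, add_zero]
      | smul r u _ hu => simp only [map_smul, hu, smul_zero]
      | mem z hz =>
        obtain ⟨a, b, rfl, h | rfl⟩ := hz
        · rw [TensorProduct.map_tmul, ih m (by omega) a h]; simp
        · simp [augConv]

/-- A bialgebra with a connected filtration has an antipode. -/
theorem exists_antipode (F : ℕ → Submodule k H) (hmono : Monotone F) (hF : ∀ x, ∃ n, x ∈ F n)
    (h0 : ∀ x ∈ F 0, algebraMap k H (Coalgebra.counit x) = x)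
    (hΔ : ∀ n, ∀ x ∈ F (n + 1), Coalgebra.comul (R := k) x ∈
      Submodule.span k {z : H ⊗[k] H | ∃ a b, z = a ⊗ₜ b ∧ (a ∈ F n ∨ b = 1)}) :
    ∃ S : H →ₗ[k] H, toConv S * toConv LinearMap.id = 1 ∧ toConv LinearMap.id * toConv S = 1 := by
  classical
  let u := augConv k H
  have hu := augConv_pow_eq_zero F hmono h0 hΔ
  let T : ℕ → WithConv (H →ₗ[k] H) := fun N => ∑ j ∈ Finset.range N, u ^ j
  have hT : ∀ x, ∃ N₀, ∀ N, N₀ ≤ N → (T N).ofConv x = (T N₀).ofConv x := by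
    intro x
    obtain ⟨n, hn⟩ := hF x
    refine ⟨n + 1, fun N hN => ?_⟩
    obtain ⟨d, rfl⟩ := Nat.exists_eq_add_of_le hN
    simp only [T, Finset.sum_range_add _ (n + 1) d, WithConv.ofConv_add, LinearMap.add_apply]
    rw [add_eq_left, WithConv.ofConv_sum, LinearMap.sum_apply]
    exact Finset.sum_eq_zero fun j _ => hu n _ (by omega) x hn
  choose N₀ hN₀ using hT
  let S : H →ₗ[k] H :=
    { toFun := fun x => (T (N₀ x)).ofConv x
      map_add' := fun x y => by
        let N := max (N₀ (x + y)) (max (N₀ x) (N₀ y))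
        rw [← hN₀ (x + y) N (by omega), ← hN₀ x N (by omega), ← hN₀ y N (by omega), map_add]
      map_smul' := fun r x => by
        let N := max (N₀ (r • x)) (N₀ x)
        rw [← hN₀ (r • x) N (by omega), ← hN₀ x N (by omega), map_smul]
        rfl }
  have hS : ∀ x N, N₀ x ≤ N → S x = (T N).ofConv x := fun x N h => (hN₀ x N h).symm
  have hid : toConv (LinearMap.id : H →ₗ[k] H) = 1 - u := by simp [u, augConv]
  have hl : ∀ z : H ⊗[k] H, ∃ N₁, ∀ N, N₁ ≤ N →
      TensorProduct.map S LinearMap.id z = TensorProduct.map (T N).ofConv LinearMap.id z := by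
    intro z
    induction z using TensorProduct.induction_on with
    | zero => exact ⟨0, by simp⟩
    | tmul a b => exact ⟨N₀ a, fun N h => by simp [hS a N h]⟩
    | add v w hv hw =>
      obtain ⟨n, hn⟩ := hv
      obtain ⟨m, hm⟩ := hw
      exact ⟨max n m, fun N h => by
        rw [map_add, map_add, hn N (by omega), hm N (by omega)]⟩
  have hr : ∀ z : H ⊗[k] H, ∃ N₁, ∀ N, N₁ ≤ N →
      TensorProduct.map LinearMap.id S z = TensorProduct.map LinearMap.id (T N).ofConv z := by
    intro z
    induction z using TensorProduct.induction_on with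
    | zero => exact ⟨0, by simp⟩
    | tmul a b => exact ⟨N₀ b, fun N h => by simp [hS b N h]⟩
    | add v w hv hw =>
      obtain ⟨n, hn⟩ := hv
      obtain ⟨m, hm⟩ := hw
      exact ⟨max n m, fun N h => by
        rw [map_add, map_add, hn N (by omega), hm N (by omega)]⟩
  refine ⟨S, ?_, ?_⟩
  · ext x
    obtain ⟨n, hn⟩ := hF x
    obtain ⟨N₁, h₁⟩ := hl (Coalgebra.comul (R := k) x)
    let N := max N₁ (n + 1)
    have h2 : (T N * toConv LinearMap.id).ofConv x = (1 : WithConv (H →ₗ[k] H)).ofConv x := by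
      rw [hid, geom_sum_mul_neg u N]
      simp only [WithConv.ofConv_sub, LinearMap.sub_apply]
      rw [hu n N (by omega) x hn, sub_zero]
    rw [← h2, LinearMap.convMul_apply, LinearMap.convMul_apply]
    dsimp only
    rw [h₁ N (by omega)]
  · ext x
    obtain ⟨n, hn⟩ := hF x
    obtain ⟨N₁, h₁⟩ := hr (Coalgebra.comul (R := k) x)
    let N := max N₁ (n + 1)
    have h2 : (toConv LinearMap.id * T N).ofConv x = (1 : WithConv (H →ₗ[k] H)).ofConv x := by
      rw [hid, mul_neg_geom_sum u N]
      simp only [WithConv.ofConv_sub, LinearMap.sub_apply]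
      rw [hu n N (by omega) x hn, sub_zero]
    rw [← h2, LinearMap.convMul_apply, LinearMap.convMul_apply]
    dsimp only
    rw [h₁ N (by omega)]

end ConnectedAntipode

/-! ## The Connes-Kreimer Hopf algebra -/

section ConnesKreimer

open RTree (mk node children cons)
open PlaneTree (leaf addChild Edge Admissible branches trunk)

variable (k : Type*) [Field k]

/-- The algebra underlying the Connes-Kreimer Hopf algebra `H_R`: the polynomial algebra with one
indeterminate for every (non-empty) rooted tree. -/
def HR : Type _ := MvPolynomial RTree k

namespace HR

noncomputable instance : CommRing (HR k) := inferInstanceAs (CommRing (MvPolynomial RTree k))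

noncomputable instance : Algebra k (HR k) := inferInstanceAs (Algebra k (MvPolynomial RTree k))

variable {k}

/-- The indeterminate of a rooted tree. -/
noncomputable def tree (t : RTree) : HR k := (MvPolynomial.X t : MvPolynomial RTree k)

/-- The monomial of a forest. -/
noncomputable def forest (F : Multiset RTree) : HR k := (F.map tree).prod

theorem forest_eq_basisMonomials (m : RTree →₀ ℕ) :
    forest (k := k) (Finsupp.toMultiset m) = MvPolynomial.basisMonomials RTree k m := by
  have h : MvPolynomial.basisMonomials RTree k m =
      ((Finsupp.toMultiset m).map (MvPolynomial.X (R := k))).prod := by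
    rw [MvPolynomial.coe_basisMonomials]
    dsimp only
    rw [MvPolynomial.monomial_eq, map_one, one_mul,
      Finsupp.toMultiset_map, Finsupp.prod_toMultiset,
      Finsupp.prod_mapDomain_index (by simp) (by intros; rw [pow_add])]
  exact h.symm

variable (k) in
open Classical in
/-- The basis of `H_R` consisting of the monomials of the forests. -/
noncomputable def forestBasis : Module.Basis (Multiset RTree) k (HR k) :=
  Module.Basis.reindex (M := HR k) (MvPolynomial.basisMonomials RTree k)
    (Multiset.toFinsupp (α := RTree)).symm.toEquiv

@[simp] theorem forestBasis_apply (F : Multiset RTree) : forestBasis k F = forest F := by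
  classical
  refine (Module.Basis.reindex_apply (M := HR k) _ _ _).trans ?_
  refine (forest_eq_basisMonomials _).symm.trans ?_
  congr 1
  exact Multiset.toFinsupp_toMultiset F

variable (k) in
/-- The operator `L`: the linear map which sends the monomial of a forest `t₁ … tₘ` to the tree
`B₊(t₁, …, tₘ)` obtained by connecting a new root to the roots of `t₁, …, tₘ`. -/
noncomputable def L : HR k →ₗ[k] HR k :=
  (forestBasis k).constr k fun F => tree (node F)

open Classical in
/-- The coproduct of a tree, `Δ(t) = 1 ⊗ t + t ⊗ 1 + ∑ P^c(t) ⊗ R^c(t)`, the sum being over the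
non-empty admissible cuts `c` of `t`. -/
noncomputable def comulTree (t : RTree) : HR k ⊗[k] HR k :=
  1 ⊗ₜ tree t + tree t ⊗ₜ 1 +
    ∑ c : Set (Edge t.plane) with Admissible t.plane c ∧ c.Nonempty,
      forest (branches t.plane c) ⊗ₜ tree (trunk t.plane c)

variable (k) in
/-- The comultiplication of `H_R`. -/
noncomputable def comulAlg : HR k →ₐ[k] HR k ⊗[k] HR k :=
  MvPolynomial.aeval (R := k) (S₁ := HR k ⊗[k] HR k) (σ := RTree) comulTree

variable (k) in
/-- The counit of `H_R`, which vanishes on all trees. -/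
noncomputable def counitAlg : HR k →ₐ[k] k :=
  MvPolynomial.aeval (R := k) (S₁ := k) (σ := RTree) fun _ => 0

@[simp] theorem comulAlg_tree (t : RTree) : comulAlg k (tree t) = comulTree t :=
  MvPolynomial.aeval_X _ _

@[simp] theorem counitAlg_tree (t : RTree) : counitAlg k (tree t) = 0 :=
  MvPolynomial.aeval_X _ _

@[simp] theorem forest_zero : forest (k := k) 0 = 1 := rfl

@[simp] theorem forest_cons (t : RTree) (F : Multiset RTree) :
    forest (k := k) (t ::ₘ F) = tree t * forest F := by simp [forest]

@[simp] theorem forest_singleton (t : RTree) : forest (k := k) {t} = tree t := by simp [forest]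

theorem forest_add (F G : Multiset RTree) :
    forest (k := k) (F + G) = forest F * forest G := by simp [forest]

@[simp] theorem L_forest (F : Multiset RTree) : L k (forest F) = tree (node F) := by
  rw [← forestBasis_apply, L, Module.Basis.constr_basis]

theorem hom_ext {M : Type*} [AddCommMonoid M] [Module k M] {f g : HR k →ₗ[k] M}
    (h : ∀ F, f (forest F) = g (forest F)) : f = g :=
  (forestBasis k).ext fun F => by simpa using h F

theorem algHom_ext {M : Type*} [Semiring M] [Algebra k M] {f g : HR k →ₐ[k] M}
    (h : ∀ t, f (tree t) = g (tree t)) : f = g :=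
  MvPolynomial.algHom_ext (σ := RTree) (f := f) (g := g) h

theorem span_forest : Submodule.span k (Set.range (forest (k := k))) = ⊤ := by
  rw [← (forestBasis k).span_eq]
  congr 2
  ext1 F
  simp

/-! ### The recursive description of the coproduct -/

open Classical in
/-- The sum over all admissible cuts, the empty one included. -/
noncomputable def cutSum (t : PlaneTree) : HR k ⊗[k] HR k :=
  ∑ c : Set (Edge t) with Admissible t c, forest (branches t c) ⊗ₜ tree (trunk t c)

open Classical in
/-- The same sum, with the root of the trunk removed. -/
noncomputable def cutSum' (t : PlaneTree) : HR k ⊗[k] HR k :=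
  ∑ c : Set (Edge t) with Admissible t c, forest (branches t c) ⊗ₜ forest (children (trunk t c))

theorem lTensor_L_cutSum' (t : PlaneTree) : (L k).lTensor (HR k) (cutSum' t) = cutSum t := by
  simp [cutSum', cutSum]

/-- A set of edges of `addChild s t` in terms of its parts. -/
def setEquiv (s t : PlaneTree) :
    Set (Edge (addChild s t)) ≃ Prop × Set (Edge s) × Set (Edge t) where
  toFun c := (Edge.new ∈ c, {a | Edge.left a ∈ c}, {a | Edge.right a ∈ c})
  invFun p := fun
    | Edge.new => p.1
    | Edge.left a => a ∈ p.2.1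
    | Edge.right a => a ∈ p.2.2
  left_inv c := by
    ext (_ | a | a) <;> rfl
  right_inv p := rfl

theorem cutSum'_leaf : cutSum' (k := k) leaf = 1 := by
  classical
  have h : ∀ c : Set (Edge leaf), c = ∅ := fun c =>
    Set.eq_empty_iff_forall_notMem.2 fun a => isEmptyElim a
  have h1 : (Finset.univ.filter fun c : Set (Edge leaf) => Admissible leaf c) = {∅} := by
    ext c
    rw [h c]
    simp only [Finset.mem_filter, Finset.mem_univ, true_and, Finset.mem_singleton, iff_true]
    exact fun v => isEmptyElim v
  rw [cutSum', h1, Finset.sum_singleton]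
  rfl

theorem cutSum'_addChild (s t : PlaneTree) :
    cutSum' (k := k) (addChild s t) = (tree (mk s) ⊗ₜ 1 + cutSum s) * cutSum' t := by
  classical
  have h0 : ∀ f : Prop → HR k ⊗[k] HR k, ∑ p : Prop, f p = f True + f False := by
    intro f
    rw [← Equiv.propEquivBool.symm.sum_comp, Fintype.sum_bool]
    congr 2 <;> simp [Equiv.propEquivBool]
  rw [cutSum', Finset.sum_filter, ← (setEquiv s t).symm.sum_comp, Fintype.sum_prod_type, h0,
    add_mul]
  congr 1
  · rw [Fintype.sum_prod_type, Finset.sum_eq_single ∅]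
    · rw [cutSum', Finset.mul_sum, Finset.sum_filter]
      refine Finset.sum_congr rfl fun c _ => ?_
      have h1 : Admissible (addChild s t) ((setEquiv s t).symm (True, ∅, c)) ↔
          Admissible t c := by
        rw [PlaneTree.admissible_addChild]
        exact and_iff_right (Or.inl ⟨trivial, rfl⟩)
      rw [if_congr h1 rfl rfl]
      refine if_congr Iff.rfl ?_ rfl
      have h2 : branches (addChild s t) ((setEquiv s t).symm (True, ∅, c)) =
          {mk s} + branches t c := by
        rw [branches, if_pos]
        · rfl
        · exact trivial
      have h3 : trunk (addChild s t) ((setEquiv s t).symm (True, ∅, c)) = trunk t c := by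
        rw [trunk, if_pos]
        · rfl
        · exact trivial
      rw [h2, h3, Multiset.singleton_add, forest_cons, Algebra.TensorProduct.tmul_mul_tmul,
        one_mul]
    · intro a _ ha
      refine Finset.sum_eq_zero fun c _ => if_neg fun h => ?_
      rw [PlaneTree.admissible_addChild] at h
      rcases h.1 with h | h
      · exact ha h.2
      · exact h.1 trivial
    · simp
  · rw [Fintype.sum_prod_type, cutSum, cutSum', Finset.sum_mul_sum, Finset.sum_filter]
    refine Finset.sum_congr rfl fun a _ => ?_
    by_cases ha : Admissible s a
    · rw [if_pos ha, Finset.sum_filter]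
      refine Finset.sum_congr rfl fun c _ => ?_
      have h1 : Admissible (addChild s t) ((setEquiv s t).symm (False, a, c)) ↔
          Admissible t c := by
        rw [PlaneTree.admissible_addChild]
        exact and_iff_right (Or.inr ⟨id, ha⟩)
      rw [if_congr h1 rfl rfl]
      refine if_congr Iff.rfl ?_ rfl
      have h2 : branches (addChild s t) ((setEquiv s t).symm (False, a, c)) =
          branches s a + branches t c := by
        rw [branches, if_neg]
        · rfl
        · exact id
      have h3 : trunk (addChild s t) ((setEquiv s t).symm (False, a, c)) =
          cons (trunk s a) (trunk t c) := by
        rw [trunk, if_neg]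
        · rfl
        · exact id
      rw [h2, h3, RTree.children_cons, forest_cons, forest_add,
        Algebra.TensorProduct.tmul_mul_tmul]
    · rw [if_neg ha]
      refine Finset.sum_eq_zero fun c _ => if_neg fun h => ?_
      rw [PlaneTree.admissible_addChild] at h
      rcases h.1 with h | h
      · exact h.1
      · exact ha h.2

theorem cutSum'_congr {s t : PlaneTree} (h : PlaneTree.Iso s t) :
    cutSum' (k := k) s = cutSum' t := by
  induction h with
  | refl => rfl
  | symm _ ih => exact ih.symm
  | trans _ _ ih ih' => exact ih.trans ih'
  | congr h _ ih ih' =>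
    rw [cutSum'_addChild, cutSum'_addChild, ih', ← lTensor_L_cutSum', ← lTensor_L_cutSum', ih]
    congr 4
    exact Quotient.sound h
  | swap => simp only [cutSum'_addChild]; ring

theorem branches_empty (t : PlaneTree) : branches t ∅ = 0 := by
  induction t with
  | leaf => rfl
  | addChild s t hs ht =>
    rw [branches, if_neg (Set.notMem_empty _)]
    simp only [Set.mem_empty_iff_false, Set.ofPred_false, hs, ht, add_zero]

theorem trunk_empty (t : PlaneTree) : trunk t ∅ = mk t := by
  induction t with
  | leaf => rfl
  | addChild s t hs ht =>
    rw [trunk, if_neg (Set.notMem_empty _)]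
    simp only [Set.mem_empty_iff_false, Set.ofPred_false, hs, ht, RTree.cons_mk]

theorem comulTree_mk (t : PlaneTree) :
    comulTree (k := k) (mk t) = tree (mk t) ⊗ₜ 1 + cutSum t := by
  classical
  have h0 : cutSum (k := k) t = cutSum (RTree.plane (mk t)) := by
    rw [← lTensor_L_cutSum', ← lTensor_L_cutSum']
    congr 1
    exact cutSum'_congr (Quotient.exact (RTree.mk_plane (mk t)).symm)
  rw [h0, comulTree, add_comm (1 ⊗ₜ _), add_assoc]
  congr 1
  rw [cutSum, ← Finset.add_sum_erase _ _ (show (∅ : Set (Edge (RTree.plane (mk t)))) ∈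
    Finset.univ.filter fun c => Admissible (RTree.plane (mk t)) c by
      simp [Admissible, Set.Subsingleton]), branches_empty, trunk_empty, RTree.mk_plane]
  congr 2
  ext c
  simp [Set.nonempty_iff_ne_empty, and_comm]

end HR

namespace HR

variable {k}

theorem comulAlg_forest_children (t : PlaneTree) :
    comulAlg k (forest (children (mk t))) = cutSum' t := by
  induction t with
  | leaf => rw [RTree.children_mk_leaf, forest_zero, map_one, cutSum'_leaf]
  | addChild s t _ ih =>
    rw [RTree.children_mk_addChild, forest_cons, map_mul, ih, comulAlg_tree, comulTree_mk,
      cutSum'_addChild]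

/-- The Hochschild equation for `L`. -/
theorem comulAlg_L (x : HR k) :
    comulAlg k (L k x) = L k x ⊗ₜ 1 + (L k).lTensor (HR k) (comulAlg k x) := by
  have h : (comulAlg k).toLinearMap ∘ₗ L k =
      (TensorProduct.mk k _ _).flip 1 ∘ₗ L k + (L k).lTensor (HR k) ∘ₗ (comulAlg k).toLinearMap := by
    refine hom_ext fun F => ?_
    obtain ⟨t, ht⟩ : ∃ t, mk t = node F := ⟨_, RTree.mk_plane _⟩
    have hF : F = children (mk t) := by rw [ht, RTree.children_node]
    subst hF
    simp only [LinearMap.comp_apply, LinearMap.add_apply, AlgHom.toLinearMap_apply, L_forest,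
      RTree.node_children, comulAlg_tree, comulTree_mk, LinearMap.flip_apply,
      TensorProduct.mk_apply, comulAlg_forest_children, lTensor_L_cutSum']
  exact LinearMap.congr_fun h x

theorem tree_eq_L (t : RTree) : tree (k := k) t = L k (forest (children t)) := by
  rw [L_forest, RTree.node_children]

/-- Algebra maps on `H_R` which agree at `L x` as soon as they agree at `x` are equal. -/
theorem algHom_ext_L {M : Type*} [Semiring M] [Algebra k M] {f g : HR k →ₐ[k] M}
    (h : ∀ x, f x = g x → f (L k x) = g (L k x)) : f = g := by
  have key : ∀ t : RTree, f (forest (children t)) = g (forest (children t)) := by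
    intro t
    induction t using RTree.ind with
    | he => simp
    | hcons s t hs ht =>
      rw [RTree.children_cons, forest_cons, map_mul, map_mul, ht, tree_eq_L, h _ hs]
  refine algHom_ext fun t => ?_
  rw [tree_eq_L]
  exact h _ (key t)

theorem counitAlg_L (x : HR k) : counitAlg k (L k x) = 0 := by
  have h : (counitAlg k).toLinearMap ∘ₗ L k = 0 := hom_ext fun F => by simp
  exact LinearMap.congr_fun h x

noncomputable instance : Bialgebra k (HR k) :=
  Bialgebra.ofAlgHom (comulAlg k) (counitAlg k)
    (by
      refine algHom_ext_L fun x hx => ?_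
      simp only [AlgHom.comp_apply] at hx ⊢
      rw [comulAlg_L]
      have h1 : ∀ z : HR k ⊗[k] HR k,
          Algebra.TensorProduct.map (comulAlg k) (AlgHom.id k (HR k)) ((L k).lTensor _ z) =
          (L k).lTensor _
            (Algebra.TensorProduct.map (comulAlg k) (AlgHom.id k (HR k)) z) := by
        intro z
        induction z using TensorProduct.induction_on with
        | zero => simp
        | tmul a b => simp
        | add u v hu hv => simp only [map_add, hu, hv]
      have h2 : ∀ z : (HR k ⊗[k] HR k) ⊗[k] HR k,
          Algebra.TensorProduct.assoc k k k (HR k) (HR k) (HR k) ((L k).lTensor _ z) =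
          ((L k).lTensor _).lTensor _
            (Algebra.TensorProduct.assoc k k k (HR k) (HR k) (HR k) z) := by
        intro z
        induction z using TensorProduct.induction_on with
        | zero => simp
        | add u v hu hv => simp only [map_add, hu, hv]
        | tmul a b =>
          induction a using TensorProduct.induction_on with
          | zero => simp
          | add u v hu hv => simp only [map_add, TensorProduct.add_tmul, hu, hv]
          | tmul a c => simp
      have h3 : ∀ z : HR k ⊗[k] HR k,
          Algebra.TensorProduct.map (AlgHom.id k (HR k)) (comulAlg k) ((L k).lTensor _ z) =
          Algebra.TensorProduct.assoc k k k (HR k) (HR k) (HR k) ((L k).lTensor _ z ⊗ₜ 1) +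
          ((L k).lTensor _).lTensor _
            (Algebra.TensorProduct.map (AlgHom.id k (HR k)) (comulAlg k) z) := by
        intro z
        induction z using TensorProduct.induction_on with
        | zero => simp
        | tmul a b => simp [comulAlg_L, TensorProduct.tmul_add]
        | add u v hu hv =>
          simp only [map_add, hu, hv, TensorProduct.add_tmul]
          abel
      have hx' : Algebra.TensorProduct.assoc k k k (HR k) (HR k) (HR k)
          (Algebra.TensorProduct.map (comulAlg k) (AlgHom.id k (HR k)) (comulAlg k x)) =
          Algebra.TensorProduct.map (AlgHom.id k (HR k)) (comulAlg k) (comulAlg k x) := hx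
      change Algebra.TensorProduct.assoc k k k (HR k) (HR k) (HR k)
          (Algebra.TensorProduct.map (comulAlg k) (AlgHom.id k (HR k)) _) = _
      rw [map_add, map_add, map_add, h1, h2, h3, hx', Algebra.TensorProduct.map_tmul,
        Algebra.TensorProduct.map_tmul, comulAlg_L, TensorProduct.add_tmul, map_add]
      simp only [AlgHom.coe_id, id_eq, map_one, Algebra.TensorProduct.one_def,
        Algebra.TensorProduct.assoc_tmul, add_assoc])
    (by
      refine algHom_ext_L fun x hx => ?_
      have hx' : Algebra.TensorProduct.map (counitAlg k) (AlgHom.id k (HR k)) (comulAlg k x) =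
        1 ⊗ₜ x := hx
      change Algebra.TensorProduct.map (counitAlg k) (AlgHom.id k (HR k))
        (comulAlg k (L k x)) = 1 ⊗ₜ L k x
      have h1 : ∀ z : HR k ⊗[k] HR k,
          Algebra.TensorProduct.map (counitAlg k) (AlgHom.id k (HR k)) ((L k).lTensor _ z) =
          (L k).lTensor _
            (Algebra.TensorProduct.map (counitAlg k) (AlgHom.id k (HR k)) z) := by
        intro z
        induction z using TensorProduct.induction_on with
        | zero => simp
        | tmul a b => simp
        | add u v hu hv => simp only [map_add, hu, hv]
      rw [comulAlg_L, map_add, h1, hx']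
      simp [counitAlg_L])
    (by
      refine algHom_ext_L fun x _ => ?_
      change Algebra.TensorProduct.map (AlgHom.id k (HR k)) (counitAlg k)
        (comulAlg k (L k x)) = L k x ⊗ₜ 1
      have h1 : ∀ z : HR k ⊗[k] HR k,
          Algebra.TensorProduct.map (AlgHom.id k (HR k)) (counitAlg k)
            ((L k).lTensor _ z) = 0 := by
        intro z
        induction z using TensorProduct.induction_on with
        | zero => simp
        | tmul a b => simp [counitAlg_L]
        | add u v hu hv => simp only [map_add, hu, hv, add_zero]
      rw [comulAlg_L, map_add, h1]
      simp)

theorem comul_eq (x : HR k) : Coalgebra.comul (R := k) x = comulAlg k x := rfl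

theorem counit_eq (x : HR k) : Coalgebra.counit (R := k) x = counitAlg k x := rfl

/-- The total number of vertices of a forest. -/
def weight (F : Multiset RTree) : ℕ := (F.map RTree.size).sum

variable (k) in
/-- The tensors of total weight `n`. -/
noncomputable def tensorWeight (n : ℕ) : Submodule k (HR k ⊗[k] HR k) :=
  Submodule.span k {z | ∃ F G, z = forest F ⊗ₜ forest G ∧ weight F + weight G = n}

theorem tensorWeight_mul {n m : ℕ} {x y : HR k ⊗[k] HR k} (hx : x ∈ tensorWeight k n)
    (hy : y ∈ tensorWeight k m) : x * y ∈ tensorWeight k (n + m) := by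
  have h : tensorWeight k n * tensorWeight k m ≤ tensorWeight k (n + m) := by
    rw [tensorWeight, tensorWeight, Submodule.span_mul_span]
    refine Submodule.span_mono ?_
    rintro _ ⟨_, ⟨F, G, rfl, h⟩, _, ⟨F', G', rfl, h'⟩, rfl⟩
    refine ⟨F + F', G + G', ?_, ?_⟩
    · simp [forest_add]
    · simp only [weight, Multiset.map_add, Multiset.sum_add] at *
      omega
  exact h (Submodule.mul_mem_mul hx hy)

theorem comulAlg_mem_tensorWeight (t : RTree) :
    comulAlg k (forest (children t)) ∈ tensorWeight k (weight (children t)) := by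
  induction t using RTree.ind with
  | he => exact Submodule.subset_span ⟨0, 0, by simp [Algebra.TensorProduct.one_def], rfl⟩
  | hcons s t hs ht =>
    rw [RTree.children_cons, forest_cons, map_mul, weight, Multiset.map_cons, Multiset.sum_cons]
    refine tensorWeight_mul ?_ ht
    rw [tree_eq_L, comulAlg_L]
    have h : s.size = weight (children s) + 1 := by
      rw [weight, ← RTree.size_node, RTree.node_children]
    refine add_mem (Submodule.subset_span ⟨{s}, 0, ?_, by simp [weight]⟩) ?_
    · rw [← tree_eq_L]; simp
    · rw [h]
      generalize weight (children s) = n at hs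
      generalize comulAlg k (forest (children s)) = z at hs ⊢
      induction hs using Submodule.span_induction with
      | zero => simp
      | add u v _ _ hu hv => rw [map_add]; exact add_mem hu hv
      | smul r u _ hu => rw [map_smul]; exact Submodule.smul_mem _ _ hu
      | mem z hz =>
        obtain ⟨F, G, rfl, hFG⟩ := hz
        refine Submodule.subset_span ⟨F, {node G}, by simp, ?_⟩
        simp [weight, RTree.size_node] at *
        omega

theorem exists_hopf : ∃ S : HR k →ₗ[k] HR k,
    toConv S * toConv LinearMap.id = 1 ∧ toConv LinearMap.id * toConv S = 1 := by
  have hw : ∀ F, weight F = 0 → F = 0 := by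
    intro F h
    rcases F.empty_or_exists_mem with rfl | ⟨t, ht⟩
    · rfl
    · have := Multiset.single_le_sum (fun _ _ => Nat.zero_le _) _
        (Multiset.mem_map_of_mem RTree.size ht)
      have := RTree.size_pos t
      rw [weight] at h
      omega
  refine exists_antipode
    (fun n => Submodule.span k {x : HR k | ∃ F, x = forest F ∧ weight F ≤ n}) ?_ ?_ ?_ ?_
  · intro n m h
    refine Submodule.span_mono ?_
    rintro _ ⟨F, rfl, hF⟩
    exact ⟨F, rfl, hF.trans h⟩
  · intro x
    have hx : x ∈ Submodule.span k (Set.range (forest (k := k))) := by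
      rw [span_forest]; trivial
    induction hx using Submodule.span_induction with
    | zero => exact ⟨0, zero_mem _⟩
    | mem x hx =>
      obtain ⟨F, rfl⟩ := hx
      exact ⟨_, Submodule.subset_span ⟨F, rfl, le_rfl⟩⟩
    | smul r u _ hu =>
      obtain ⟨n, hn⟩ := hu
      exact ⟨n, Submodule.smul_mem _ _ hn⟩
    | add u v _ _ hu hv =>
      obtain ⟨n, hn⟩ := hu
      obtain ⟨m, hm⟩ := hv
      refine ⟨max n m, add_mem (Submodule.span_mono ?_ hn) (Submodule.span_mono ?_ hm)⟩ <;>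
      · rintro _ ⟨F, rfl, hF⟩
        exact ⟨F, rfl, by omega⟩
  · intro x hx
    induction hx using Submodule.span_induction with
    | zero => simp
    | mem x hx =>
      obtain ⟨F, rfl, hF⟩ := hx
      rw [hw F (by omega)]
      simp
    | smul r u _ hu => rw [map_smul, smul_eq_mul, map_mul, hu, Algebra.smul_def]
    | add u v _ _ hu hv => rw [map_add, map_add, hu, hv]
  · intro n x hx
    induction hx using Submodule.span_induction with
    | zero => simp
    | smul r u _ hu => rw [map_smul]; exact Submodule.smul_mem _ _ hu
    | add u v _ _ hu hv => rw [map_add]; exact add_mem hu hv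
    | mem x hx =>
      obtain ⟨F, rfl, hF⟩ := hx
      have h := comulAlg_mem_tensorWeight (k := k) (node F)
      rw [RTree.children_node] at h
      refine Submodule.span_mono ?_ h
      rintro _ ⟨F', G', rfl, h'⟩
      refine ⟨_, _, rfl, ?_⟩
      by_cases h0 : weight G' = 0
      · right
        rw [hw G' h0, forest_zero]
      · left
        exact Submodule.subset_span ⟨F', rfl, by omega⟩

/-- The Connes-Kreimer Hopf algebra. Its antipode is the convolution inverse of the identity. -/
noncomputable instance : HopfAlgebra k (HR k) :=
  HopfAlgebra.ofConvInverse exists_hopf.choose exists_hopf.choose_spec.1 exists_hopf.choose_spec.2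

end HR
end ConnesKreimer

/-! ## The auxiliary bialgebra of forests in which the trees are primitive -/

section GrossmanLarson

open RTree (mk node children cons)
open PlaneTree (leaf addChild Edge Vertex graft graftForest)

variable (k : Type*) [Field k]

/-- The polynomial algebra in the rooted trees, as a bialgebra in which all trees are primitive. -/
def PrimForest : Type _ := HR k

namespace PrimForest

noncomputable instance : CommRing (PrimForest k) := inferInstanceAs (CommRing (HR k))

noncomputable instance : Algebra k (PrimForest k) := inferInstanceAs (Algebra k (HR k))

variable {k}

/-- The indeterminate of a tree. -/
noncomputable def tree (t : RTree) : PrimForest k := HR.tree t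

/-- The monomial of a forest. -/
noncomputable def forest (F : Multiset RTree) : PrimForest k := HR.forest F

variable (k) in
/-- The basis of monomials. -/
noncomputable def forestBasis : Module.Basis (Multiset RTree) k (PrimForest k) := HR.forestBasis k

variable (k) in
/-- The operator `B₊`. -/
noncomputable def L : PrimForest k →ₗ[k] PrimForest k := HR.L k

@[simp] theorem forestBasis_apply (F : Multiset RTree) : forestBasis k F = forest F :=
  HR.forestBasis_apply F

@[simp] theorem L_forest (F : Multiset RTree) : L k (forest F) = tree (node F) := HR.L_forest F

@[simp] theorem forest_zero : forest (k := k) 0 = 1 := rfl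

@[simp] theorem forest_cons (t : RTree) (F : Multiset RTree) :
    forest (k := k) (t ::ₘ F) = tree t * forest F := HR.forest_cons t F

theorem forest_add (F G : Multiset RTree) :
    forest (k := k) (F + G) = forest F * forest G := HR.forest_add F G

theorem forest_eq_prod (F : Multiset RTree) : forest (k := k) F = (F.map tree).prod := rfl

theorem hom_ext {M : Type*} [AddCommMonoid M] [Module k M] {f g : PrimForest k →ₗ[k] M}
    (h : ∀ F, f (forest F) = g (forest F)) : f = g := HR.hom_ext (f := f) (g := g) h

theorem algHom_ext {M : Type*} [Semiring M] [Algebra k M] {f g : PrimForest k →ₐ[k] M}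
    (h : ∀ t, f (tree t) = g (tree t)) : f = g := HR.algHom_ext (f := f) (g := g) h

theorem tree_eq_L (t : RTree) : tree (k := k) t = L k (forest (children t)) := HR.tree_eq_L t

/-- Algebra maps are prescribed on trees. -/
noncomputable def lift {M : Type*} [CommSemiring M] [Algebra k M] (f : RTree → M) :
    PrimForest k →ₐ[k] M :=
  MvPolynomial.aeval (R := k) (S₁ := M) (σ := RTree) f

@[simp] theorem lift_tree {M : Type*} [CommSemiring M] [Algebra k M] (f : RTree → M) (t : RTree) :
    lift (k := k) f (tree t) = f t := MvPolynomial.aeval_X _ _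

theorem lift_forest {M : Type*} [CommSemiring M] [Algebra k M] (f : RTree → M)
    (F : Multiset RTree) : lift (k := k) f (forest F) = (F.map f).prod := by
  rw [forest_eq_prod, map_multiset_prod, Multiset.map_map]
  simp

noncomputable instance : Bialgebra k (PrimForest k) :=
  Bialgebra.ofAlgHom (lift fun t => tree t ⊗ₜ 1 + 1 ⊗ₜ tree t) (lift fun _ => 0)
    (algHom_ext fun t => by
      simp [Algebra.TensorProduct.one_def, TensorProduct.add_tmul, TensorProduct.tmul_add,
        add_assoc])
    (algHom_ext fun t => by simp)
    (algHom_ext fun t => by simp)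

theorem comul_eq (x : PrimForest k) : Coalgebra.comul (R := k) x =
    lift (fun t => tree t ⊗ₜ[k] 1 + 1 ⊗ₜ[k] tree t) x := rfl

theorem counit_eq (x : PrimForest k) :
    Coalgebra.counit (R := k) x = lift (fun _ => (0 : k)) x := rfl

noncomputable instance : Coalgebra.IsCocomm k (PrimForest k) where
  comm_comp_comul := by
    have h : (Algebra.TensorProduct.comm k (PrimForest k) (PrimForest k)).toAlgHom.comp
        (Bialgebra.comulAlgHom k _) = Bialgebra.comulAlgHom k (PrimForest k) := by
      refine algHom_ext fun t => ?_
      simp [comul_eq, add_comm]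
    exact congr(($h).toLinearMap)

theorem comul_forest (F : Multiset RTree) : Coalgebra.comul (R := k) (forest (k := k) F) =
    (F.antidiagonal.map fun p => forest p.1 ⊗ₜ[k] forest p.2).sum := by
  have h1 : ∀ F : Multiset RTree, (F.map fun t => tree (k := k) t ⊗ₜ[k] (1 : PrimForest k)).prod =
      forest F ⊗ₜ 1 := by
    intro F
    induction F using Multiset.induction with
    | empty => simp [Algebra.TensorProduct.one_def]
    | cons t F ih => simp [ih]
  have h2 : ∀ F : Multiset RTree, (F.map fun t => (1 : PrimForest k) ⊗ₜ[k] tree (k := k) t).prod =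
      1 ⊗ₜ forest F := by
    intro F
    induction F using Multiset.induction with
    | empty => simp [Algebra.TensorProduct.one_def]
    | cons t F ih => simp [ih]
  rw [comul_eq, lift_forest, Multiset.prod_map_add]
  simp [h1, h2]

theorem comul_L (x : PrimForest k) :
    Coalgebra.comul (R := k) (L k x) = L k x ⊗ₜ 1 + 1 ⊗ₜ L k x := by
  have h : Coalgebra.comul (R := k) ∘ₗ L k =
      (TensorProduct.mk k _ _).flip 1 ∘ₗ L k + TensorProduct.mk k _ _ 1 ∘ₗ L k :=
    hom_ext fun F => by simp [comul_eq]
  exact LinearMap.congr_fun h x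

theorem counit_L (x : PrimForest k) : Coalgebra.counit (R := k) (L k x) = 0 := by
  have h : Coalgebra.counit (R := k) ∘ₗ L k = 0 := hom_ext fun F => by simp [counit_eq]
  exact LinearMap.congr_fun h x

/-- Linear endomorphisms under convolution. -/
abbrev Conv (k : Type*) [Field k] := WithConv (PrimForest k →ₗ[k] PrimForest k)

/-- For a tree `t`, the map sending a forest `F` to the sum of the forests obtained by attaching the
trees of `F` to the vertices of `t` other than the root, and then removing the root. -/
noncomputable def psiPlane : PlaneTree → Conv k
  | leaf => 1
  | addChild s t => toConv (L k ∘ₗ (toConv LinearMap.id * psiPlane s).ofConv) * psiPlane t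

/-- The same map for non-plane trees. -/
noncomputable def psi : RTree → Conv k :=
  Quotient.lift psiPlane fun s t h => by
    change PlaneTree.Iso s t at h
    induction h with
    | refl => rfl
    | symm _ ih => exact ih.symm
    | trans _ _ ih ih' => exact ih.trans ih'
    | congr h _ ih ih' => simp only [psiPlane, ih, ih']
    | swap => simp only [psiPlane]; exact mul_left_comm _ _ _

theorem psi_e : psi (k := k) RTree.e = 1 := rfl

theorem psi_cons (s t : RTree) :
    psi (k := k) (cons s t) = toConv (L k ∘ₗ (toConv LinearMap.id * psi s).ofConv) * psi t := by
  induction s using Quotient.inductionOn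
  induction t using Quotient.inductionOn
  rfl

variable (k) in
/-- `phi G F` is the sum of the forests obtained by attaching the trees of `F` to the vertices of
the forest `G`. -/
noncomputable def phi : PrimForest k →ₐ[k] Conv k :=
  lift fun t => toConv (L k ∘ₗ (toConv LinearMap.id * psi t).ofConv)

theorem phi_forest_children (t : RTree) : phi k (forest (children t)) = psi t := by
  induction t using RTree.ind with
  | he => simp [psi_e]
  | hcons s t _ ih => rw [RTree.children_cons, forest_cons, map_mul, ih, psi_cons, phi, lift_tree]

variable (k) in
/-- `lam G F` is the Grossman-Larson product of `F` and `G`, in terms of forests. -/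
noncomputable def lam : PrimForest k →ₗ[k] Conv k :=
  LinearMap.mulLeft k (toConv LinearMap.id) ∘ₗ (phi k).toLinearMap

theorem lam_apply (G : PrimForest k) : lam k G = toConv LinearMap.id * phi k G := rfl

theorem phi_L (x : PrimForest k) : phi k (L k x) = toConv (L k ∘ₗ (lam k x).ofConv) := by
  have h : (phi k).toLinearMap ∘ₗ L k = (WithConv.linearEquiv k _).symm.toLinearMap ∘ₗ
      LinearMap.compRight k (L k) ∘ₗ (WithConv.linearEquiv k _).toLinearMap ∘ₗ lam k := by
    refine hom_ext fun F => ?_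
    have hF : forest (k := k) F = forest (children (node F)) := by rw [RTree.children_node]
    rw [LinearMap.comp_apply, L_forest, AlgHom.toLinearMap_apply, phi, lift_tree,
      ← phi_forest_children, ← hF]
    rfl
  exact LinearMap.congr_fun h x

/-- Induction for subspaces of the forest algebra. -/
theorem forest_induction {P : PrimForest k → Prop} (h1 : P 1)
    (hmul : ∀ x y, P x → P (L k y) → P (L k y * x)) (hL : ∀ x, P x → P (L k x))
    (hadd : ∀ x y, P x → P y → P (x + y)) (hsmul : ∀ (r : k) x, P x → P (r • x))
    (x : PrimForest k) : P x := by
  have key : ∀ t, P (forest (children t)) := by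
    intro t
    induction t using RTree.ind with
    | he => simpa using h1
    | hcons s t hs ht =>
      rw [RTree.children_cons, forest_cons, tree_eq_L]
      exact hmul _ _ ht (hL _ hs)
  have hx : x ∈ Submodule.span k (Set.range (forestBasis k)) := by
    rw [(forestBasis k).span_eq]; trivial
  induction hx using Submodule.span_induction with
  | zero => simpa using hsmul 0 1 h1
  | smul r u _ hu => exact hsmul r u hu
  | add u v _ _ hu hv => exact hadd u v hu hv
  | mem x hx =>
    obtain ⟨F, rfl⟩ := hx
    rw [forestBasis_apply, ← RTree.children_node F]
    exact key _

/-- The tensor square of a family of linear maps. -/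
noncomputable def sq (f : PrimForest k →ₗ[k] Conv k) :
    PrimForest k ⊗[k] PrimForest k →ₗ[k]
      PrimForest k ⊗[k] PrimForest k →ₗ[k] PrimForest k ⊗[k] PrimForest k :=
  TensorProduct.homTensorHomMap (RingHom.id k) _ _ _ _ ∘ₗ
    TensorProduct.map ((WithConv.linearEquiv k _).toLinearMap ∘ₗ f)
      ((WithConv.linearEquiv k _).toLinearMap ∘ₗ f)

theorem sq_tmul (f : PrimForest k →ₗ[k] Conv k) (a b : PrimForest k) :
    sq f (a ⊗ₜ b) = TensorProduct.map (f a).ofConv (f b).ofConv := rfl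

theorem sq_phi_mul (y z : PrimForest k ⊗[k] PrimForest k) :
    toConv (sq (phi k).toLinearMap (y * z)) =
      toConv (sq (phi k).toLinearMap y) * toConv (sq (phi k).toLinearMap z) := by
  induction y using TensorProduct.induction_on with
  | zero => simp
  | add u v hu hv => simp only [add_mul, map_add, toConv_add, hu, hv]
  | tmul a b =>
    induction z using TensorProduct.induction_on with
    | zero => simp
    | add u v hu hv => simp only [mul_add, map_add, toConv_add, hu, hv]
    | tmul c d =>
      rw [Algebra.TensorProduct.tmul_mul_tmul, sq_tmul, sq_tmul, sq_tmul]
      refine Eq.trans ?_ TensorProduct.map_convMul_map.symm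
      simp

theorem id_mul_sq_phi (y : PrimForest k ⊗[k] PrimForest k) :
    toConv LinearMap.id * toConv (sq (phi k).toLinearMap y) = toConv (sq (lam k) y) := by
  induction y using TensorProduct.induction_on with
  | zero => simp
  | add u v hu hv => simp only [mul_add, map_add, toConv_add, hu, hv]
  | tmul a b =>
    rw [sq_tmul, sq_tmul, ← TensorProduct.map_id]
    exact TensorProduct.map_convMul_map (f := toConv LinearMap.id) (g := toConv LinearMap.id)

theorem map_one_comul (f : PrimForest k →ₗ[k] PrimForest k) (F : PrimForest k) :
    TensorProduct.map f (1 : Conv k).ofConv (Coalgebra.comul (R := k) F) = f F ⊗ₜ 1 := by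
  have h : TensorProduct.map f (1 : Conv k).ofConv =
      TensorProduct.map f (Algebra.linearMap k (PrimForest k)) ∘ₗ
        Coalgebra.counit.lTensor (PrimForest k) := by
    rw [LinearMap.map_comp_lTensor]; rfl
  rw [h, LinearMap.comp_apply, Coalgebra.lTensor_counit_comul]
  simp

theorem one_map_comul (f : PrimForest k →ₗ[k] PrimForest k) (F : PrimForest k) :
    TensorProduct.map (1 : Conv k).ofConv f (Coalgebra.comul (R := k) F) = 1 ⊗ₜ f F := by
  have h : TensorProduct.map (1 : Conv k).ofConv f =
      TensorProduct.map (Algebra.linearMap k (PrimForest k)) f ∘ₗ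
        Coalgebra.counit.rTensor (PrimForest k) := by
    rw [LinearMap.map_comp_rTensor]; rfl
  rw [h, LinearMap.comp_apply, Coalgebra.rTensor_counit_comul]
  simp

theorem comul_phi (G : PrimForest k) : Coalgebra.comul (R := k) ∘ₗ (phi k G).ofConv =
    sq (phi k).toLinearMap (Coalgebra.comul (R := k) G) ∘ₗ Coalgebra.comul := by
  induction G using forest_induction with
  | h1 =>
    ext F
    rw [Bialgebra.comul_one, Algebra.TensorProduct.one_def, sq_tmul]
    simp only [AlgHom.toLinearMap_apply, map_one, LinearMap.comp_apply]
    rw [map_one_comul]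
    change Coalgebra.comul (R := k) (algebraMap k _ (Coalgebra.counit (R := k) F)) =
      algebraMap k _ (Coalgebra.counit (R := k) F) ⊗ₜ 1
    rw [Bialgebra.comul_algebraMap]
    rfl
  | hadd x y hx hy => simp only [map_add, ofConv_add, LinearMap.comp_add, LinearMap.add_comp, hx, hy]
  | hsmul r x hx =>
    simp only [map_smul, ofConv_smul, LinearMap.comp_smul, LinearMap.smul_comp, hx]
  | hL x _ =>
    ext1 F
    rw [comul_L, map_add, sq_tmul, sq_tmul]
    simp only [AlgHom.toLinearMap_apply, map_one, LinearMap.comp_apply, LinearMap.add_apply]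
    rw [map_one_comul, one_map_comul, phi_L]
    exact comul_L _
  | hmul x y hx hy =>
    have h1 := LinearMap.algHom_comp_convMul_distrib (Bialgebra.comulAlgHom k (PrimForest k))
      (phi k (L k y)) (phi k x)
    have h2 := LinearMap.convMul_comp_coalgHom_distrib
      (toConv (sq (phi k).toLinearMap (Coalgebra.comul (R := k) (L k y))))
      (toConv (sq (phi k).toLinearMap (Coalgebra.comul (R := k) x)))
      (Coalgebra.comulCoalgHom k (PrimForest k))
    rw [← sq_phi_mul, ← Bialgebra.comul_mul] at h2
    rw [map_mul]
    refine Eq.trans h1 (Eq.trans ?_ h2.symm)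
    congr 3

theorem comul_lam (G : PrimForest k) : Coalgebra.comul (R := k) ∘ₗ (lam k G).ofConv =
    sq (lam k) (Coalgebra.comul (R := k) G) ∘ₗ Coalgebra.comul := by
  have h1 := LinearMap.algHom_comp_convMul_distrib (Bialgebra.comulAlgHom k (PrimForest k))
    (toConv LinearMap.id) (phi k G)
  have h2 := LinearMap.convMul_comp_coalgHom_distrib (toConv LinearMap.id)
    (toConv (sq (phi k).toLinearMap (Coalgebra.comul (R := k) G)))
    (Coalgebra.comulCoalgHom k (PrimForest k))
  rw [id_mul_sq_phi] at h2
  rw [lam_apply]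
  refine Eq.trans h1 (Eq.trans ?_ h2.symm)
  congr 3
  exact comul_phi G

/-- Convolution products composed with `lam G`. -/
theorem convMul_comp_lam (f g : Conv k) (G : PrimForest k) {T : PrimForest k →ₗ[k] Conv k}
    (h : ∀ a b, toConv (f.ofConv ∘ₗ (lam k a).ofConv) * toConv (g.ofConv ∘ₗ (lam k b).ofConv) =
      T (f.ofConv a * g.ofConv b)) :
    toConv ((f * g).ofConv ∘ₗ (lam k G).ofConv) = T ((f * g).ofConv G) := by
  have h1 : (f * g).ofConv ∘ₗ (lam k G).ofConv = LinearMap.mul' k _ ∘ₗ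
      TensorProduct.map f.ofConv g.ofConv ∘ₗ
        sq (lam k) (Coalgebra.comul (R := k) G) ∘ₗ Coalgebra.comul := by
    rw [← comul_lam]; rfl
  have h2 : ∀ z : PrimForest k ⊗[k] PrimForest k,
      toConv (LinearMap.mul' k _ ∘ₗ TensorProduct.map f.ofConv g.ofConv ∘ₗ
        sq (lam k) z ∘ₗ Coalgebra.comul) =
      T (LinearMap.mul' k _ (TensorProduct.map f.ofConv g.ofConv z)) := by
    intro z
    induction z using TensorProduct.induction_on with
    | zero => simp
    | add u v hu hv =>
      simp only [map_add, LinearMap.add_comp, LinearMap.comp_add, toConv_add, hu, hv]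
    | tmul a b =>
      rw [TensorProduct.map_tmul, LinearMap.mul'_apply, ← h, sq_tmul, LinearMap.convMul_def,
        ofConv_toConv, ofConv_toConv, TensorProduct.map_comp]
      rfl
  rw [h1, h2]
  rfl

theorem lam_comp_lam_of {x : PrimForest k}
    (h : ∀ G, toConv ((phi k x).ofConv ∘ₗ (lam k G).ofConv) = phi k ((phi k x).ofConv G))
    (G : PrimForest k) :
    toConv ((lam k x).ofConv ∘ₗ (lam k G).ofConv) = lam k ((lam k x).ofConv G) := by
  rw [lam_apply x]
  refine convMul_comp_lam _ _ _ fun a b => ?_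
  rw [h]
  change (toConv LinearMap.id * phi k a) * phi k ((phi k x).ofConv b) =
    toConv LinearMap.id * phi k (a * (phi k x).ofConv b)
  rw [map_mul, mul_assoc]

theorem counit_conv_mul (f g : Conv k) {a b : k}
    (hf : ∀ x, Coalgebra.counit (R := k) (f.ofConv x) = a * Coalgebra.counit (R := k) x)
    (hg : ∀ x, Coalgebra.counit (R := k) (g.ofConv x) = b * Coalgebra.counit (R := k) x)
    (x : PrimForest k) : Coalgebra.counit (R := k) ((f * g).ofConv x) =
      (a * b) * Coalgebra.counit (R := k) x := by
  let r := Coalgebra.Repr.arbitrary k x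
  rw [show (f * g).ofConv x = _ from r.convMul_apply f g, map_sum]
  simp only [Bialgebra.counit_mul, hf, hg]
  conv_rhs => rw [← Coalgebra.sum_counit_smul r, map_sum]
  rw [Finset.mul_sum]
  refine Finset.sum_congr rfl fun i _ => ?_
  rw [map_smul, smul_eq_mul]
  ring

theorem counit_phi (G F : PrimForest k) : Coalgebra.counit (R := k) ((phi k G).ofConv F) =
    Coalgebra.counit (R := k) G * Coalgebra.counit (R := k) F := by
  induction G using forest_induction generalizing F with
  | h1 => simp
  | hadd x y hx hy => simp [hx, hy, add_mul]
  | hsmul r x hx => simp [hx, mul_assoc]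
  | hL x hx => simp [phi_L, counit_L]
  | hmul x y hx hy =>
    rw [map_mul, Bialgebra.counit_mul]
    exact counit_conv_mul _ _ hy hx F

theorem counit_lam (G F : PrimForest k) : Coalgebra.counit (R := k) ((lam k G).ofConv F) =
    Coalgebra.counit (R := k) G * Coalgebra.counit (R := k) F := by
  rw [lam_apply, counit_conv_mul _ _ (a := 1) (fun _ => (one_mul _).symm) (counit_phi G), one_mul]

theorem one_comp_lam (G : PrimForest k) :
    toConv ((1 : Conv k).ofConv ∘ₗ (lam k G).ofConv) = phi k ((1 : Conv k).ofConv G) := by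
  rw [LinearMap.convOne_apply, AlgHom.commutes]
  ext F
  rw [ofConv_toConv, LinearMap.comp_apply, LinearMap.convOne_apply, counit_lam, map_mul,
    LinearMap.convAlgebraMap_apply, Algebra.smul_def]

theorem phi_comp_lam (x : PrimForest k) (G : PrimForest k) :
    toConv ((phi k x).ofConv ∘ₗ (lam k G).ofConv) = phi k ((phi k x).ofConv G) := by
  induction x using forest_induction generalizing G with
  | h1 => rw [map_one, one_comp_lam]
  | hadd x y hx hy =>
    simp only [map_add, ofConv_add, LinearMap.add_comp, toConv_add, hx, hy, LinearMap.add_apply]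
  | hsmul r x hx =>
    simp only [map_smul, ofConv_smul, LinearMap.smul_comp, toConv_smul, hx, LinearMap.smul_apply]
  | hL x hx =>
    rw [phi_L, ofConv_toConv, LinearMap.comp_apply, phi_L, ← lam_comp_lam_of hx G,
      ofConv_toConv, LinearMap.comp_assoc]
  | hmul x y hx hy =>
    rw [map_mul]
    refine convMul_comp_lam (T := (phi k).toLinearMap) _ _ _ fun a b => ?_
    rw [hx, hy, AlgHom.toLinearMap_apply, map_mul]

/-- Associativity of the Grossman-Larson product. -/
theorem lam_assoc (F G K : PrimForest k) :
    (lam k K).ofConv ((lam k G).ofConv F) = (lam k ((lam k K).ofConv G)).ofConv F := by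
  rw [← lam_comp_lam_of (phi_comp_lam K) G]
  rfl

theorem lam_one (F : PrimForest k) : (lam k 1).ofConv F = F := by
  rw [lam_apply, map_one, mul_one]
  rfl

theorem conv_mul_one (f g : Conv k) :
    (f * g).ofConv 1 = f.ofConv 1 * g.ofConv 1 := by
  rw [LinearMap.convMul_apply, Bialgebra.comul_one, Algebra.TensorProduct.one_def]
  simp

theorem phi_apply_one (G : PrimForest k) : (phi k G).ofConv 1 = G := by
  induction G using forest_induction with
  | h1 => simp
  | hadd x y hx hy => simp [hx, hy]
  | hsmul r x hx => simp [hx]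
  | hL x hx =>
    rw [phi_L, ofConv_toConv, LinearMap.comp_apply, lam_apply, conv_mul_one, hx]
    simp
  | hmul x y hx hy => rw [map_mul, conv_mul_one, hx, hy]

theorem lam_apply_one (G : PrimForest k) : (lam k G).ofConv 1 = G := by
  rw [lam_apply, conv_mul_one, phi_apply_one]
  simp

end PrimForest

namespace PrimForest

variable {k}

section Distributions

variable {V A B : Type}

open Classical in
variable (k V) in
/-- The formal sum of all distributions of the trees of `F` among the elements of `V`. -/
noncomputable def distr [Fintype V] (F : Multiset RTree) : AddMonoidAlgebra k (V → Multiset RTree) :=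
  (F.map fun s => ∑ v : V, AddMonoidAlgebra.single (Pi.single v {s}) 1).prod

/-- Linear extension of a map on distributions. -/
noncomputable def extend (K : (V → Multiset RTree) → PrimForest k) :
    AddMonoidAlgebra k (V → Multiset RTree) →ₗ[k] PrimForest k :=
  Finsupp.linearCombination k K ∘ₗ (AddMonoidAlgebra.coeffLinearEquiv k).toLinearMap

@[simp] theorem extend_single (K : (V → Multiset RTree) → PrimForest k) (g r) :
    extend K (AddMonoidAlgebra.single g r) = r • K g := by
  simp [extend]

/-- The sum of `K` over all distributions, as a linear map on forests. -/
noncomputable def sumDistr [Fintype V] (K : (V → Multiset RTree) → PrimForest k) : Conv k :=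
  toConv ((forestBasis k).constr k fun F => extend K (distr k V F))

theorem sumDistr_forest [Fintype V] (K : (V → Multiset RTree) → PrimForest k) (F : Multiset RTree) :
    (sumDistr K).ofConv (forest F) = extend K (distr k V F) := by
  rw [sumDistr, ← forestBasis_apply, ofConv_toConv, Module.Basis.constr_basis]

open Classical in
theorem sum_functions [Fintype V] (K : (V → Multiset RTree) → PrimForest k) {n : ℕ} (l : Fin n → RTree) :
    ∑ φ : Fin n → V, K (fun v => ∑ i with φ i = v, {l i}) =
      (sumDistr K).ofConv (forest (Finset.univ.val.map l)) := by
  have h : distr k V (Finset.univ.val.map l) = ∑ φ : Fin n → V,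
      AddMonoidAlgebra.single (fun v => ∑ i with φ i = v, {l i}) (1 : k) := by
    rw [distr, Multiset.map_map]
    change ∏ i : Fin n, ∑ v : V, _ = _
    rw [Finset.prod_univ_sum, Fintype.piFinset_univ]
    refine Finset.sum_congr rfl fun φ _ => ?_
    have h1 := map_prod (AddMonoidAlgebra.of k (V → Multiset RTree))
      (fun i => Multiplicative.ofAdd (Pi.single (φ i) {l i})) Finset.univ
    simp only [AddMonoidAlgebra.of_apply, toAdd_ofAdd] at h1
    rw [← h1, toAdd_prod]
    congr 1
    ext1 v
    rw [Finset.sum_apply, Finset.sum_filter]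
    refine Finset.sum_congr rfl fun i _ => ?_
    simp [Pi.single_apply, eq_comm]
  rw [sumDistr_forest, h, map_sum]
  simp

theorem sumDistr_sum [Fintype V] [Fintype A] [Fintype B] (e : A ⊕ B ≃ V) (KA : (A → Multiset RTree) → PrimForest k)
    (KB : (B → Multiset RTree) → PrimForest k) :
    sumDistr (fun g : V → Multiset RTree => KA (fun a => g (e (Sum.inl a))) *
      KB (fun b => g (e (Sum.inr b)))) = sumDistr KA * sumDistr KB := by
  classical
  let iA : (A → Multiset RTree) →+ (V → Multiset RTree) :=
    { toFun := fun g v => Sum.elim g (fun _ => 0) (e.symm v)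
      map_zero' := by ext1 v; rcases e.symm v <;> simp
      map_add' := fun g g' => by ext1 v; rcases h : e.symm v <;> simp [h] }
  let iB : (B → Multiset RTree) →+ (V → Multiset RTree) :=
    { toFun := fun g v => Sum.elim (fun _ => 0) g (e.symm v)
      map_zero' := by ext1 v; rcases e.symm v <;> simp
      map_add' := fun g g' => by ext1 v; rcases h : e.symm v <;> simp [h] }
  let K := fun g : V → Multiset RTree => KA (fun a => g (e (Sum.inl a))) *
    KB (fun b => g (e (Sum.inr b)))
  have h1 : ∀ a s, iA (Pi.single a {s}) = Pi.single (e (Sum.inl a)) {s} := by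
    intro a s
    ext1 v
    obtain ⟨v, rfl⟩ := e.surjective v
    rcases v with v | v <;> simp [iA, Pi.single_apply]
  have h2 : ∀ a s, iB (Pi.single a {s}) = Pi.single (e (Sum.inr a)) {s} := by
    intro a s
    ext1 v
    obtain ⟨v, rfl⟩ := e.surjective v
    rcases v with v | v <;> simp [iB, Pi.single_apply]
  let jA := AddMonoidAlgebra.mapDomainRingHom k iA
  let jB := AddMonoidAlgebra.mapDomainRingHom k iB
  have h3 : ∀ F, distr k V F = (F.antidiagonal.map fun p =>
      jA (distr k A p.1) * jB (distr k B p.2)).sum := by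
    intro F
    have h4 : ∀ s : RTree, (∑ v : V, AddMonoidAlgebra.single (Pi.single v {s}) (1 : k)) =
        jA (∑ a : A, AddMonoidAlgebra.single (Pi.single a {s}) 1) +
        jB (∑ a : B, AddMonoidAlgebra.single (Pi.single a {s}) 1) := by
      intro s
      rw [← e.sum_comp, Fintype.sum_sum_type, map_sum, map_sum]
      simp [jA, jB, h1, h2]
    simp only [distr, h4, Multiset.prod_map_add, map_multiset_prod, Multiset.map_map]
    rfl
  have h5 : ∀ x y, extend K (jA x * jB y) = extend KA x * extend KB y := by
    intro x y
    induction x using AddMonoidAlgebra.induction_linear with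
    | zero => simp
    | add f g hf hg => simp only [map_add, add_mul, hf, hg]
    | single g r =>
      induction y using AddMonoidAlgebra.induction_linear with
      | zero => simp
      | add f g hf hg => simp only [map_add, mul_add, hf, hg]
      | single g' r' =>
        have e1 : jA (AddMonoidAlgebra.single g r) = AddMonoidAlgebra.single (iA g) r := by
          simp [jA]
        have e2 : jB (AddMonoidAlgebra.single g' r') = AddMonoidAlgebra.single (iB g') r' := by
          simp [jB]
        have e3 : K (iA g + iB g') = KA g * KB g' := by simp [K, iA, iB]
        rw [e1, e2, AddMonoidAlgebra.single_mul_single, extend_single, extend_single,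
          extend_single, e3, smul_mul_smul_comm]
  refine WithConv.ext (hom_ext fun F => ?_)
  rw [sumDistr_forest, h3, map_multiset_sum, Multiset.map_map, LinearMap.convMul_apply,
    comul_forest, map_multiset_sum, map_multiset_sum, Multiset.map_map, Multiset.map_map]
  congr 1
  refine Multiset.map_congr rfl fun p _ => ?_
  simp only [Function.comp_apply, TensorProduct.map_tmul, LinearMap.mul'_apply, sumDistr_forest]
  exact h5 _ _

theorem sumDistr_comp [Fintype V] (f : PrimForest k →ₗ[k] PrimForest k)
    (K : (V → Multiset RTree) → PrimForest k) :
    sumDistr (fun g => f (K g)) = toConv (f ∘ₗ (sumDistr K).ofConv) := by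
  have h : extend (fun g => f (K g)) = f ∘ₗ extend K := by
    ext g; simp
  refine WithConv.ext (hom_ext fun F => ?_)
  rw [sumDistr_forest, h, ofConv_toConv, LinearMap.comp_apply, LinearMap.comp_apply,
    sumDistr_forest]

theorem sumDistr_unit :
    sumDistr (fun g : PUnit → Multiset RTree => forest (k := k) (g PUnit.unit)) =
      toConv LinearMap.id := by
  refine WithConv.ext (hom_ext fun F => ?_)
  rw [sumDistr_forest]
  have h : distr k PUnit F = AddMonoidAlgebra.single (fun _ => F) 1 := by
    induction F using Multiset.induction with
    | empty => rfl
    | cons s F ih =>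
      rw [distr, Multiset.map_cons, Multiset.prod_cons, ← distr, ih]
      simp only [Finset.univ_unique, Finset.sum_singleton, AddMonoidAlgebra.single_mul_single,
        mul_one]
      congr 1
      ext1 v
      simp
  rw [h]
  simp

theorem sumDistr_empty [Fintype V] [IsEmpty V] (K : (V → Multiset RTree) → PrimForest k)
    (hK : ∀ g, K g = 1) : sumDistr K = 1 := by
  refine WithConv.ext (hom_ext fun F => ?_)
  rw [sumDistr_forest, LinearMap.convOne_apply]
  induction F using Multiset.induction with
  | empty =>
    have : distr k V 0 = AddMonoidAlgebra.single 0 1 := rfl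
    rw [this]
    simp [hK]
  | cons s F ih => simp [distr, counit_eq]

end Distributions

theorem sumDistr_edge_vertex (t : PlaneTree) :
    sumDistr (fun g : Edge t → Multiset RTree => forest (k := k) (graftForest t g)) = psi (mk t) ∧
    sumDistr (fun g : Vertex t → Multiset RTree =>
      forest (k := k) (g none + graftForest t fun a => g (some a))) =
      toConv LinearMap.id * psi (mk t) := by
  have key : ∀ t : PlaneTree,
      sumDistr (fun g : Edge t → Multiset RTree => forest (k := k) (graftForest t g)) =
        psi (mk t) →
      sumDistr (fun g : Vertex t → Multiset RTree =>
        forest (k := k) (g none + graftForest t fun a => g (some a))) =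
        toConv LinearMap.id * psi (mk t) := by
    intro t ht
    rw [← ht, mul_comm, ← sumDistr_unit, ← sumDistr_sum (Equiv.optionEquivSumPUnit (Edge t)).symm]
    congr 1
    ext1 g
    rw [forest_add, mul_comm]
    rfl
  suffices h : sumDistr (fun g : Edge t → Multiset RTree => forest (k := k) (graftForest t g)) =
      psi (mk t) from ⟨h, key t h⟩
  induction t with
  | leaf => exact sumDistr_empty _ fun _ => rfl
  | addChild s t hs ht =>
    rw [← RTree.cons_mk, psi_cons, ← ht, ← key s hs, ← sumDistr_comp,
      ← sumDistr_sum (PlaneTree.Edge.equiv s t)]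
    congr 1
    ext1 g
    rw [graftForest, forest_cons, L_forest]
    rfl

end PrimForest

end GrossmanLarson

/-! ## The Grossman-Larson Hopf algebra -/

section GrossmanLarson

open RTree (mk node children cons)
open PlaneTree (leaf addChild Edge Vertex graft graftForest)

variable (k : Type*) [Field k]

/-- The vector space underlying the Grossman-Larson Hopf algebra: its basis consists of all
(non-empty) rooted trees. -/
def GrossmanLarson : Type _ := RTree →₀ k

namespace GrossmanLarson

noncomputable instance instAddCommGroup : AddCommGroup (GrossmanLarson k) := inferInstanceAs (AddCommGroup (RTree →₀ k))

noncomputable instance : Module k (GrossmanLarson k) := inferInstanceAs (Module k (RTree →₀ k))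

variable {k}

variable (k) in
/-- The basis of rooted trees. -/
noncomputable def basis : Module.Basis RTree k (GrossmanLarson k) := ⟨LinearEquiv.refl k (RTree →₀ k)⟩

/-- A rooted tree as an element of the Grossman-Larson algebra. -/
noncomputable def of (t : RTree) : GrossmanLarson k := basis k t

open Classical in
/-- The product of two trees: the sum over all ways `φ` to attach the subtrees `s₁, …, s_r` below
the root of `t₁` to the vertices of `t₂`, making each `sᵢ` a child of the vertex `φ i`. -/
noncomputable def mulTree (t₁ t₂ : RTree) : GrossmanLarson k :=
  ∑ φ : Fin (children t₁).toList.length → Vertex t₂.plane,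
    of (graft t₂.plane fun v => ∑ i with φ i = v, {(children t₁).toList[i]})

variable (k) in
/-- The product, as a bilinear map. -/
noncomputable def mulLin : GrossmanLarson k →ₗ[k] GrossmanLarson k →ₗ[k] GrossmanLarson k :=
  (basis k).constr k fun t₁ => (basis k).constr k fun t₂ => mulTree t₁ t₂

variable (k) in
/-- The coproduct of a tree `t` is the sum over all ways to distribute the subtrees below its root
among two trees. -/
noncomputable def comulLin : GrossmanLarson k →ₗ[k] GrossmanLarson k ⊗[k] GrossmanLarson k :=
  (basis k).constr k fun t =>
    ((children t).antidiagonal.map fun p => of (node p.1) ⊗ₜ of (node p.2)).sum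

variable (k) in
open Classical in
/-- The counit is `1` on the tree `e` with one vertex and `0` on all other trees. -/
noncomputable def counitLin : GrossmanLarson k →ₗ[k] k :=
  (basis k).constr k fun t => if t = RTree.e then 1 else 0

/-- Trees correspond to forests by removing the root. -/
def childrenEquiv : RTree ≃ Multiset RTree where
  toFun := children
  invFun := node
  left_inv := RTree.node_children
  right_inv := RTree.children_node

variable (k) in
/-- The linear isomorphism with the forest algebra given by removing the root. -/
noncomputable def toForest : GrossmanLarson k ≃ₗ[k] PrimForest k :=
  (basis k).equiv (PrimForest.forestBasis k) childrenEquiv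

@[simp] theorem toForest_of (t : RTree) :
    toForest k (of t) = PrimForest.forest (children t) := by
  rw [toForest, of, Module.Basis.equiv_apply, PrimForest.forestBasis_apply]
  rfl

theorem toForest_mulTree (t₁ t₂ : RTree) : toForest k (mulTree t₁ t₂) =
    (PrimForest.lam k (PrimForest.forest (children t₂))).ofConv
      (PrimForest.forest (children t₁)) := by
  classical
  have h := (PrimForest.sumDistr_edge_vertex (k := k) t₂.plane).2
  rw [RTree.mk_plane, ← PrimForest.phi_forest_children, ← PrimForest.lam_apply] at h
  have h1 : (Finset.univ.val.map fun i : Fin (children t₁).toList.length =>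
      (children t₁).toList[i]) = children t₁ := by
    rw [Fin.univ_val_map]
    simp only [Fin.getElem_fin, List.ofFn_getElem, Multiset.coe_toList]
  rw [← h]
  conv_rhs => rw [← h1]
  rw [← PrimForest.sum_functions, mulTree, map_sum]
  refine Finset.sum_congr rfl fun φ _ => ?_
  rw [toForest_of, graft, RTree.children_node]
  congr!

theorem toForest_mulLin (a b : GrossmanLarson k) : toForest k (mulLin k a b) =
    (PrimForest.lam k (toForest k b)).ofConv (toForest k a) := by
  have h : (mulLin k).compr₂ (toForest k).toLinearMap = (((WithConv.linearEquiv k _).toLinearMap ∘ₗ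
      PrimForest.lam k).flip).compl₁₂ (toForest k).toLinearMap (toForest k).toLinearMap := by
    refine (basis k).ext fun t₁ => (basis k).ext fun t₂ => ?_
    have h1 := toForest_mulTree (k := k) t₁ t₂
    rw [← toForest_of, ← toForest_of] at h1
    simp only [LinearMap.compr₂_apply, mulLin, Module.Basis.constr_basis]
    exact h1
  exact LinearMap.congr_fun₂ h a b

noncomputable instance : Ring (GrossmanLarson k) where
  __ := instAddCommGroup k
  mul a b := mulLin k a b
  one := of RTree.e
  left_distrib a b c := map_add (mulLin k a) b c
  right_distrib a b c := LinearMap.map_add₂ (mulLin k) a b c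
  zero_mul a := LinearMap.map_zero₂ (mulLin k) a
  mul_zero a := map_zero (mulLin k a)
  mul_assoc a b c := (toForest k).injective <| by
    change toForest k (mulLin k (mulLin k a b) c) = toForest k (mulLin k a (mulLin k b c))
    simp only [toForest_mulLin, PrimForest.lam_assoc]
  one_mul a := (toForest k).injective <| by
    change toForest k (mulLin k (of RTree.e) a) = toForest k a
    rw [toForest_mulLin, toForest_of, RTree.children_e, PrimForest.forest_zero,
      PrimForest.lam_apply_one]
  mul_one a := (toForest k).injective <| by
    change toForest k (mulLin k a (of RTree.e)) = toForest k a
    rw [toForest_mulLin, toForest_of, RTree.children_e, PrimForest.forest_zero,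
      PrimForest.lam_one]

theorem mul_eq (a b : GrossmanLarson k) : a * b = mulLin k a b := rfl

theorem one_eq : (1 : GrossmanLarson k) = of RTree.e := rfl

theorem of_mul_of (t₁ t₂ : RTree) : of (k := k) t₁ * of t₂ = mulTree t₁ t₂ := by
  rw [mul_eq, mulLin, of, of, Module.Basis.constr_basis, Module.Basis.constr_basis]

theorem toForest_one : toForest k 1 = 1 := by rw [one_eq, toForest_of]; rfl

noncomputable instance : Algebra k (GrossmanLarson k) :=
  Algebra.ofModule (fun r a b => LinearMap.map_smul₂ (mulLin k) r a b)
    (fun r a b => map_smul (mulLin k a) r b)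

theorem map_toForest_comulLin (a : GrossmanLarson k) :
    TensorProduct.map (toForest k).toLinearMap (toForest k).toLinearMap (comulLin k a) =
      Coalgebra.comul (R := k) (toForest k a) := by
  have h : TensorProduct.map (toForest k).toLinearMap (toForest k).toLinearMap ∘ₗ comulLin k =
      Coalgebra.comul (R := k) ∘ₗ (toForest k).toLinearMap := by
    refine (basis k).ext fun t => ?_
    change TensorProduct.map _ _ (comulLin k (basis k t)) = Coalgebra.comul (toForest k (of t))
    rw [comulLin, Module.Basis.constr_basis, toForest_of, PrimForest.comul_forest,
      map_multiset_sum, Multiset.map_map]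
    congr 1
    refine Multiset.map_congr rfl fun p _ => ?_
    simp
  exact LinearMap.congr_fun h a

theorem counit_toForest (a : GrossmanLarson k) :
    Coalgebra.counit (R := k) (toForest k a) = counitLin k a := by
  have h : Coalgebra.counit (R := k) ∘ₗ (toForest k).toLinearMap = counitLin k := by
    refine (basis k).ext fun t => ?_
    change Coalgebra.counit (toForest k (of t)) = counitLin k (basis k t)
    rw [toForest_of, counitLin, Module.Basis.constr_basis]
    induction t using RTree.ind with
    | he => simp
    | hcons s t _ _ =>
      rw [if_neg, RTree.children_cons, PrimForest.forest_cons, PrimForest.counit_eq]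
      · simp
      · intro h
        have := congrArg children h
        simp at this
  exact LinearMap.congr_fun h a

theorem toForest_counit_eq : counitLin k = Coalgebra.counit (R := k) ∘ₗ (toForest k).toLinearMap :=
  LinearMap.ext fun a => (counit_toForest a).symm

theorem map_toForest_injective : Function.Injective
    (TensorProduct.map (toForest k).toLinearMap (toForest k).toLinearMap) :=
  (TensorProduct.congr (toForest k) (toForest k)).injective

noncomputable instance : Coalgebra k (GrossmanLarson k) where
  comul := comulLin k
  counit := counitLin k
  coassoc := by
    ext1 a
    apply (TensorProduct.congr (toForest k)
      (TensorProduct.congr (toForest k) (toForest k))).injective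
    have h := Coalgebra.coassoc_apply (R := k) (toForest k a)
    rw [← map_toForest_comulLin] at h
    simp only [LinearMap.comp_apply, LinearEquiv.coe_coe]
    generalize comulLin k a = z at h ⊢
    have h1 : ∀ z : GrossmanLarson k ⊗[k] GrossmanLarson k, TensorProduct.congr (toForest k)
        (TensorProduct.congr (toForest k) (toForest k))
          (TensorProduct.assoc k _ _ _ ((comulLin k).rTensor _ z)) =
        TensorProduct.assoc k _ _ _ (Coalgebra.comul.rTensor _
          (TensorProduct.map (toForest k).toLinearMap (toForest k).toLinearMap z)) := by
      intro z
      induction z using TensorProduct.induction_on with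
      | zero => simp
      | add u v hu hv => simp only [map_add, hu, hv]
      | tmul a b =>
        simp only [LinearMap.rTensor_tmul, TensorProduct.map_tmul, LinearEquiv.coe_coe,
          ← map_toForest_comulLin]
        generalize comulLin k a = w
        induction w using TensorProduct.induction_on with
        | zero => simp
        | add u v hu hv => simp only [map_add, TensorProduct.add_tmul, hu, hv]
        | tmul c d => simp
    have h2 : ∀ z : GrossmanLarson k ⊗[k] GrossmanLarson k, TensorProduct.congr (toForest k)
        (TensorProduct.congr (toForest k) (toForest k)) ((comulLin k).lTensor _ z) =
        Coalgebra.comul.lTensor _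
          (TensorProduct.map (toForest k).toLinearMap (toForest k).toLinearMap z) := by
      intro z
      induction z using TensorProduct.induction_on with
      | zero => simp
      | add u v hu hv => simp only [map_add, hu, hv]
      | tmul a b =>
        simp only [LinearMap.lTensor_tmul, TensorProduct.map_tmul, LinearEquiv.coe_coe,
          ← map_toForest_comulLin]
        rfl
    rw [h1, h2, h]
  rTensor_counit_comp_comul := by
    ext1 a
    apply (TensorProduct.congr (LinearEquiv.refl k k) (toForest k)).injective
    have h := Coalgebra.rTensor_counit_comul (R := k) (toForest k a)
    rw [← map_toForest_comulLin, LinearMap.rTensor, TensorProduct.map_map] at h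
    simp only [LinearMap.comp_apply]
    refine Eq.trans ?_ (h.trans ?_)
    · generalize comulLin k a = z
      induction z using TensorProduct.induction_on with
      | zero => simp
      | add u v hu hv => simp only [map_add, hu, hv]
      | tmul a b => simp [counit_toForest]
    · simp
  lTensor_counit_comp_comul := by
    ext1 a
    apply (TensorProduct.congr (toForest k) (LinearEquiv.refl k k)).injective
    have h := Coalgebra.lTensor_counit_comul (R := k) (toForest k a)
    rw [← map_toForest_comulLin, LinearMap.lTensor, TensorProduct.map_map] at h
    simp only [LinearMap.comp_apply]
    refine Eq.trans ?_ (h.trans ?_)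
    · generalize comulLin k a = z
      induction z using TensorProduct.induction_on with
      | zero => simp
      | add u v hu hv => simp only [map_add, hu, hv]
      | tmul a b => simp [counit_toForest]
    · simp

theorem comul_eq (a : GrossmanLarson k) : Coalgebra.comul (R := k) a = comulLin k a := rfl

theorem counit_eq (a : GrossmanLarson k) : Coalgebra.counit (R := k) a = counitLin k a := rfl

theorem map_toForest_mul (y z : GrossmanLarson k ⊗[k] GrossmanLarson k) :
    TensorProduct.map (toForest k).toLinearMap (toForest k).toLinearMap (y * z) =
      PrimForest.sq (PrimForest.lam k)
        (TensorProduct.map (toForest k).toLinearMap (toForest k).toLinearMap z)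
        (TensorProduct.map (toForest k).toLinearMap (toForest k).toLinearMap y) := by
  induction y using TensorProduct.induction_on with
  | zero => simp
  | add u v hu hv => simp only [add_mul, map_add, hu, hv]
  | tmul a b =>
    induction z using TensorProduct.induction_on with
    | zero => simp
    | add u v hu hv => simp only [mul_add, map_add, hu, hv, LinearMap.add_apply]
    | tmul c d =>
      rw [Algebra.TensorProduct.tmul_mul_tmul, TensorProduct.map_tmul, TensorProduct.map_tmul,
        PrimForest.sq_tmul, TensorProduct.map_tmul, TensorProduct.map_tmul]
      simp only [LinearEquiv.coe_coe, mul_eq, toForest_mulLin]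

noncomputable instance : Bialgebra k (GrossmanLarson k) :=
  Bialgebra.mk' k (GrossmanLarson k)
    (by rw [counit_eq, ← counit_toForest, toForest_one, Bialgebra.counit_one])
    (by
      intro a b
      simp only [counit_eq, ← counit_toForest, mul_eq, toForest_mulLin, PrimForest.counit_lam]
      rw [mul_comm])
    (by
      apply map_toForest_injective
      rw [comul_eq, map_toForest_comulLin, toForest_one, Bialgebra.comul_one,
        Algebra.TensorProduct.one_def, Algebra.TensorProduct.one_def, TensorProduct.map_tmul]
      simp [toForest_one])
    (by
      intro a b
      apply map_toForest_injective
      rw [map_toForest_mul]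
      simp only [comul_eq, map_toForest_comulLin]
      rw [mul_eq, toForest_mulLin]
      exact LinearMap.congr_fun (PrimForest.comul_lam (toForest k b)) (toForest k a))

theorem exists_hopf : ∃ S : GrossmanLarson k →ₗ[k] GrossmanLarson k,
    toConv S * toConv LinearMap.id = 1 ∧ toConv LinearMap.id * toConv S = 1 := by
  refine exists_antipode
    (fun n => Submodule.span k {x : GrossmanLarson k | ∃ F, x = of (node F) ∧ F.card ≤ n}) ?_ ?_ ?_ ?_
  · intro n m h
    refine Submodule.span_mono ?_
    rintro _ ⟨F, rfl, hF⟩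
    exact ⟨F, rfl, hF.trans h⟩
  · intro x
    have hx : x ∈ Submodule.span k (Set.range (basis k)) := by
      rw [(basis k).span_eq]; trivial
    induction hx using Submodule.span_induction with
    | zero => exact ⟨0, zero_mem _⟩
    | mem x hx =>
      obtain ⟨t, rfl⟩ := hx
      exact ⟨_, Submodule.subset_span ⟨children t, by rw [RTree.node_children]; rfl, le_rfl⟩⟩
    | smul r u _ hu =>
      obtain ⟨n, hn⟩ := hu
      exact ⟨n, Submodule.smul_mem _ _ hn⟩
    | add u v _ _ hu hv =>
      obtain ⟨n, hn⟩ := hu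
      obtain ⟨m, hm⟩ := hv
      refine ⟨max n m, add_mem (Submodule.span_mono ?_ hn) (Submodule.span_mono ?_ hm)⟩ <;>
      · rintro _ ⟨F, rfl, hF⟩
        exact ⟨F, rfl, by omega⟩
  · intro x hx
    induction hx using Submodule.span_induction with
    | zero => simp
    | mem x hx =>
      obtain ⟨F, rfl, hF⟩ := hx
      have h0 : F = 0 := Multiset.card_eq_zero.1 (by omega)
      rw [h0, RTree.node_zero, ← one_eq]
      simp
    | smul r u _ hu => rw [map_smul, smul_eq_mul, map_mul, hu, Algebra.smul_def]
    | add u v _ _ hu hv => rw [map_add, map_add, hu, hv]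
  · intro n x hx
    induction hx using Submodule.span_induction with
    | zero => simp
    | smul r u _ hu => rw [map_smul]; exact Submodule.smul_mem _ _ hu
    | add u v _ _ hu hv => rw [map_add]; exact add_mem hu hv
    | mem x hx =>
      obtain ⟨F, rfl, hF⟩ := hx
      rw [comul_eq, comulLin, of, Module.Basis.constr_basis, RTree.children_node]
      refine multiset_sum_mem _ fun z hz => ?_
      obtain ⟨p, hp, rfl⟩ := Multiset.mem_map.1 hz
      refine Submodule.subset_span ⟨_, _, rfl, ?_⟩
      have h1 := congrArg Multiset.card (Multiset.mem_antidiagonal.1 hp)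
      rw [Multiset.card_add] at h1
      by_cases h2 : p.2 = 0
      · right
        rw [h2]; rfl
      · left
        have := Multiset.card_pos.2 h2
        exact Submodule.subset_span ⟨p.1, rfl, by omega⟩

/-- The Grossman-Larson Hopf algebra. Its antipode is the convolution inverse of the identity. -/
noncomputable instance : HopfAlgebra k (GrossmanLarson k) :=
  HopfAlgebra.ofConvInverse exists_hopf.choose exists_hopf.choose_spec.1 exists_hopf.choose_spec.2

variable (k) in
open Classical in
/-- The natural growth operator `N`: the tree `t` is sent to the sum, over the vertices `v` of `t`,
of the trees obtained from `t` by attaching one more outgoing edge and vertex to `v`. -/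
noncomputable def N : GrossmanLarson k →ₗ[k] GrossmanLarson k :=
  (basis k).constr k fun t => ∑ v : Vertex t.plane, of (graft t.plane (Pi.single v {RTree.e}))

variable (k) in
open Classical in
/-- The linear map `M` with `M(e) = 0` and `M(t) = t N(e)` for all trees `t ≠ e`. -/
noncomputable def M : GrossmanLarson k →ₗ[k] GrossmanLarson k :=
  (basis k).constr k fun t => if t = RTree.e then 0 else of t * N k (of RTree.e)

end GrossmanLarson

end GrossmanLarson

end

namespace HR

open RTree (mk node children cons)
open PlaneTree (leaf addChild)

section Lift

variable {k C : Type*} [Field k] [CommRing C] [Algebra k C]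

/-- The value at the forest below the root of a plane tree of the algebra map that intertwines `L`
with `T`. -/
noncomputable def liftPlane (T : C →ₗ[k] C) : PlaneTree → C
  | leaf => 1
  | addChild s t => T (liftPlane T s) * liftPlane T t

theorem liftPlane_congr (T : C →ₗ[k] C) {s t : PlaneTree} (h : PlaneTree.Iso s t) :
    liftPlane T s = liftPlane T t := by
  induction h with
  | refl => rfl
  | symm _ ih => exact ih.symm
  | trans _ _ ih ih' => exact ih.trans ih'
  | congr _ _ ih ih' => simp only [liftPlane, ih, ih']
  | swap => simp only [liftPlane]; exact mul_left_comm _ _ _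

/-- The value at the forest below the root of a tree of the algebra map that intertwines `L`
with `T`. -/
noncomputable def liftTree (T : C →ₗ[k] C) : RTree → C :=
  Quotient.lift (liftPlane T) fun _ _ h => liftPlane_congr T h

theorem liftTree_e (T : C →ₗ[k] C) : liftTree T RTree.e = 1 := rfl

theorem liftTree_cons (T : C →ₗ[k] C) (s t : RTree) :
    liftTree T (cons s t) = T (liftTree T s) * liftTree T t := by
  induction s using Quotient.inductionOn
  induction t using Quotient.inductionOn
  rfl

/-- The algebra map from `H_R` to a commutative algebra that intertwines `L` with a given linear
endomorphism `T`. -/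
noncomputable def lift (T : C →ₗ[k] C) : HR k →ₐ[k] C :=
  MvPolynomial.aeval (R := k) (S₁ := C) (σ := RTree) fun t => T (liftTree T t)

theorem lift_tree (T : C →ₗ[k] C) (t : RTree) : lift T (tree t) = T (liftTree T t) :=
  MvPolynomial.aeval_X _ _

theorem lift_forest_children (T : C →ₗ[k] C) (t : RTree) :
    lift T (forest (children t)) = liftTree T t := by
  induction t using RTree.ind with
  | he => simp [liftTree_e]
  | hcons s t _ ih =>
    rw [RTree.children_cons, forest_cons, map_mul, ih, lift_tree, liftTree_cons]

theorem lift_L (T : C →ₗ[k] C) (x : HR k) : lift T (L k x) = T (lift T x) := by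
  have h : (lift T).toLinearMap ∘ₗ L k = T ∘ₗ (lift T).toLinearMap := by
    refine hom_ext fun F => ?_
    have hF := lift_forest_children T (node F)
    rw [RTree.children_node] at hF
    simp only [LinearMap.comp_apply, L_forest, AlgHom.toLinearMap_apply, lift_tree, hF]
  exact LinearMap.congr_fun h x

end Lift

section LiftBialg

variable {k C : Type*} [Field k] [CommRing C] [Bialgebra k C]

/-- If `T` is a Hochschild cocycle, the algebra map that intertwines `L` with `T` is a map of
bialgebras. -/
noncomputable def liftBialg (T : C →ₗ[k] C) (hT : HochschildEquation T)
    (hε : ∀ x, Coalgebra.counit (R := k) (T x) = 0) : HR k →ₐc[k] C :=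
  BialgHom.ofAlgHom (lift T)
    (by
      refine algHom_ext_L fun x _ => ?_
      change Coalgebra.counit (R := k) (lift T (L k x)) = counitAlg k (L k x)
      rw [lift_L, hε, counitAlg_L])
    (by
      refine algHom_ext_L fun x hx => ?_
      have hx' : Algebra.TensorProduct.map (lift T) (lift T) (comulAlg k x) =
        Coalgebra.comul (R := k) (lift T x) := hx
      change Algebra.TensorProduct.map (lift T) (lift T) (comulAlg k (L k x)) =
        Coalgebra.comul (R := k) (lift T (L k x))
      have h1 : ∀ z : HR k ⊗[k] HR k,
          Algebra.TensorProduct.map (lift T) (lift T) ((L k).lTensor _ z) =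
            T.lTensor C (Algebra.TensorProduct.map (lift T) (lift T) z) := by
        intro z
        induction z using TensorProduct.induction_on with
        | zero => simp
        | tmul a b => simp [lift_L]
        | add u v hu hv => simp only [map_add, hu, hv]
      rw [comulAlg_L, map_add, h1, hx', lift_L, hT (lift T x)]
      simp [lift_L])

/-- The universal property of `H_R` among commutative bialgebras with a Hochschild cocycle. -/
theorem existsUnique_bialgHom (T : C →ₗ[k] C) (hT : HochschildEquation T)
    (hε : ∀ x, Coalgebra.counit (R := k) (T x) = 0) :
    ∃! ρ : HR k →ₐc[k] C, T ∘ₗ (ρ : HR k →ₗ[k] C) = (ρ : HR k →ₗ[k] C) ∘ₗ L k := by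
  refine ⟨liftBialg T hT hε, LinearMap.ext fun x => (lift_L T x).symm, fun σ hσ => ?_⟩
  have hσ' : ∀ x, T (σ x) = σ (L k x) := fun x => LinearMap.congr_fun hσ x
  have h : (σ : HR k →ₐ[k] C) = lift T := by
    refine algHom_ext_L fun x hx => ?_
    have hx' : σ x = lift T x := hx
    change σ (L k x) = lift T (L k x)
    rw [← hσ', hx', lift_L]
  exact BialgHom.ext fun x => AlgHom.congr_fun h x

end LiftBialg

end HR

namespace FiniteDual

variable {k A : Type*} [Field k] [Ring A] [Bialgebra k A]

/-- The finite dual of a cocommutative bialgebra is commutative. -/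
noncomputable abbrev commRing [Coalgebra.IsCocomm k A] : CommRing (FiniteDual k A) where
  mul_comm f g := Subtype.ext (mul_comm f.1 g.1)

theorem counit_restrictTranspose (T : A →ₗ[k] A)
    (hT : ∀ f : Module.Dual k A, IsFiniteFunctional f → IsFiniteFunctional (T.dualMap f))
    (h1 : T 1 = 0) (f : FiniteDual k A) :
    Coalgebra.counit (R := k) (restrictTranspose T hT f) = 0 := by
  change toDual f (T 1) = 0
  rw [h1, map_zero]

/-- The transpose of a linear map satisfying `T (a b) = ε(b) T a + a T b` is a Hochschild
cocycle. -/
theorem hochschildEquation_restrictTranspose (T : A →ₗ[k] A)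
    (hT : ∀ f : Module.Dual k A, IsFiniteFunctional f → IsFiniteFunctional (T.dualMap f))
    (hmul : ∀ a b, T (a * b) = Coalgebra.counit (R := k) b • T a + a * T b) :
    HochschildEquation (restrictTranspose T hT) := by
  intro f
  refine ext₂ fun a b => ?_
  have h : ∀ z : FiniteDual k A ⊗[k] FiniteDual k A,
      ev₂ a b ((restrictTranspose T hT).lTensor _ z) = ev₂ a (T b) z := by
    intro z
    induction z using TensorProduct.induction_on with
    | zero => simp
    | tmul u v =>
      rw [LinearMap.lTensor_tmul, ev₂_tmul, ev₂_tmul]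
      rfl
    | add u v hu hv => simp only [map_add, hu, hv]
  rw [map_add, h, ev₂_comul, ev₂_comul, ev₂_tmul, toDual_one]
  change toDual f (T (a * b)) = toDual f (T a) * _ + _
  rw [hmul, map_add, map_smul, smul_eq_mul, mul_comm]

end FiniteDual

theorem IsFiniteFunctional.dualMap_mulRight {k A : Type*} [Field k] [Ring A] [Algebra k A]
    {f : A →ₗ[k] k} (hf : IsFiniteFunctional f) (x : A) :
    IsFiniteFunctional ((LinearMap.mulRight k x).dualMap f) := by
  obtain ⟨I, hI, hfin, hIf⟩ := hf
  exact ⟨I, hI, hfin, fun a ha => hIf (hI x a ha).2⟩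

theorem isFiniteFunctional_counit (k A : Type*) [Field k] [Ring A] [Bialgebra k A] :
    IsFiniteFunctional (Coalgebra.counit : A →ₗ[k] k) := by
  rw [← FiniteDual.toDual_one]
  exact FiniteDual.isFiniteFunctional 1

namespace GrossmanLarson

variable {k : Type*} [Field k]

instance : Coalgebra.IsCocomm k (GrossmanLarson k) where
  comm_comp_comul := by
    ext1 a
    apply map_toForest_injective
    have h : ∀ z : GrossmanLarson k ⊗[k] GrossmanLarson k,
        TensorProduct.map (toForest k).toLinearMap (toForest k).toLinearMap
          (TensorProduct.comm k _ _ z) = TensorProduct.comm k _ _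
            (TensorProduct.map (toForest k).toLinearMap (toForest k).toLinearMap z) := by
      intro z
      induction z using TensorProduct.induction_on with
      | zero => simp
      | tmul a b => simp
      | add u v hu hv => simp only [map_add, hu, hv]
    change TensorProduct.map _ _ (TensorProduct.comm k _ _ (comulLin k a)) =
      TensorProduct.map _ _ (comulLin k a)
    rw [h, map_toForest_comulLin, Coalgebra.comm_comul]

theorem M_apply (a : GrossmanLarson k) :
    M k a = a * N k (of RTree.e) - Coalgebra.counit (R := k) a • N k (of RTree.e) := by
  have h : M k = LinearMap.mulRight k (N k (of RTree.e)) -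
      (Coalgebra.counit (R := k) (A := GrossmanLarson k)).smulRight (N k (of RTree.e)) := by
    refine (basis k).ext fun t => ?_
    rw [M, Module.Basis.constr_basis, LinearMap.sub_apply, LinearMap.mulRight_apply,
      LinearMap.smulRight_apply, counit_eq, counitLin, Module.Basis.constr_basis]
    split_ifs with ht
    · rw [ht, ← of, ← one_eq, one_mul, one_smul, sub_self]
    · rw [zero_smul, sub_zero, of]
  exact LinearMap.congr_fun h a

theorem M_one : M k 1 = 0 := by
  rw [M_apply, Bialgebra.counit_one, one_mul, one_smul, sub_self]

theorem M_mul (a b : GrossmanLarson k) :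
    M k (a * b) = Coalgebra.counit (R := k) b • M k a + a * M k b := by
  simp only [M_apply, Bialgebra.counit_mul, mul_sub, smul_sub, mul_smul_comm, mul_assoc, mul_smul]
  rw [smul_comm (Coalgebra.counit (R := k) b) (Coalgebra.counit (R := k) a)]
  abel

theorem isFiniteFunctional_dualMap_M (f : Module.Dual k (GrossmanLarson k))
    (hf : IsFiniteFunctional f) : IsFiniteFunctional ((M k).dualMap f) := by
  refine (hf.dualMap_mulRight (N k (of RTree.e))).of_inf
    (isFiniteFunctional_counit k (GrossmanLarson k)) fun a ha => ?_
  have h1 : f (a * N k (of RTree.e)) = 0 := ha.1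
  have h2 : Coalgebra.counit (R := k) a = 0 := ha.2
  rw [LinearMap.mem_ker, LinearMap.dualMap_apply, M_apply, h2, zero_smul, sub_zero, h1]

end GrossmanLarson

theorem proposition5 (k : Type*) [Field k] [CharZero k] :
    ∃ hM : ∀ f : Module.Dual k (GrossmanLarson k), IsFiniteFunctional f →
        IsFiniteFunctional ((GrossmanLarson.M k).dualMap f),
      HochschildEquation (FiniteDual.restrictTranspose (GrossmanLarson.M k) hM) ∧
      ∃! ρ : HR k →ₐc[k] FiniteDual k (GrossmanLarson k),
        FiniteDual.restrictTranspose (GrossmanLarson.M k) hM ∘ₗ (ρ : HR k →ₗ[k] _) =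
          (ρ : HR k →ₗ[k] _) ∘ₗ HR.L k := by
  let _ : CommRing (FiniteDual k (GrossmanLarson k)) := FiniteDual.commRing
  have hH := FiniteDual.hochschildEquation_restrictTranspose (GrossmanLarson.M k)
    GrossmanLarson.isFiniteFunctional_dualMap_M GrossmanLarson.M_mul
  exact ⟨GrossmanLarson.isFiniteFunctional_dualMap_M, hH, HR.existsUnique_bialgHom _ hH
    (FiniteDual.counit_restrictTranspose _ _ GrossmanLarson.M_one)⟩
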